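/- Let $\eta\in\mathbb C$ with $\operatorname{Im}\eta>0$, let $E=\mathbb C/(\mathbb Z+\mathbb Z\eta)$, and put $\theta(z)=\sum_{k\in\mathbb Z}(-1)^k e^{2\pi i\left(kz+\frac{k(k-1)}2\eta\right)}$. For an integer $n\ge 3$ and $\alpha\in\mathbb Z/n$ let $$\theta_\alpha(z)=e^{2\pi i\left(\alpha z+\frac{\alpha(\alpha-n)}{2n}\eta+\frac{\alpha}{2n}\right)}\prod_{s=0}^{n-1}\theta\left(z+\tfrac sn+\tfrac{\alpha}{n}\eta\right)$$ be the theta functions of order $n$ (one has $\theta_{\alpha+n}=\theta_\alpha$). The $n$-dimensional Sklyanin algebra $Q_{n,1}(E,\tau)$ is the graded $\mathbb C$-algebra generated by $x_i$, $i\in\mathbb Z/n$, in degree $1$, with the relations $$\sum_{r\in\mathbb Z/n}\frac{\theta_{j-i}(0)}{\theta_{j-i-r}(-\tau)\,\theta_r(\tau)}\,x_{j-r}x_{i+r}=0,\qquad i,j\in\mathbb Z/n,\ i\neq j.$$ A graded Clifford algebra (on $n$ generators) is an algebra isomorphic, as a graded algebra, to the algebra $A(M)$ generated by $x_1,\dots,x_n$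 (in degree $1$) and $y_1,\dots,y_n$ (in degree $2$) with relations $x_ix_j+x_jx_i=M_{ij}$, $[x_i,y_j]=0$, $[y_i,y_j]=0$, where $M$ is a symmetric $n\times n$ matrix of linear forms in $\mathbb C[y_1,\dots,y_n]$ with $\det M\neq0$. The Heisenberg group $H_p=\langle e_1,e_2,z\mid e_1^p=e_2^p=z^p=1,\ e_1e_2=ze_2e_1,\ e_1z=ze_1,\ e_2z=ze_2\rangle$ acts on the free algebra $\mathbb C\langle x_i: i\in\mathbb Z/p\rangle$ by algebra automorphisms with $e_1x_i=x_{i-1}$, $e_2x_i=\omega^ix_i$, $zx_i=\omega x_i$, $\omega=e^{2\pi i/p}$. **Theorem.** Let $p$ be an odd prime and let $\tau$ be a point of order $2$ on $E$. Then the Sklyanin algebra $Q_{p,1}(E,\tau)$ is a graded Clifford algebra on $p$ generators. Moreover, there are $a_1,\dots,a_{(p-1)/2}\in\mathbb C$ such that the space of quadratic relations of $Q_{p,1}(E,\tau)$ (the span, in the free algebra, of the left-hand sides above) is spanned by the $H_p$-orbits of the elements $\{x_i,x_{-i}\}+a_ix_0^2$, $1\le i\le\frac{p-1}2$, where $\{u,v\}=uv+vu$;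 and the elements $e_1^k\cdot\left(\{x_i,x_{-i}\}+a_ix_0^2\right)$, $1\le i\le\frac{p-1}2$, $0\le k<p$, form a basis of this space. -/

import Mathlib

noncomputable section

namespace SklyaninClifford

open Complex

/-! ### Elliptic curves and theta functions -/

/-- The lattice `ℤ + ℤ η` in `ℂ`. -/
def lattice (η : UpperHalfPlane) : AddSubgroup ℂ :=
  AddSubgroup.closure {1, (η : ℂ)}

/-- The complex elliptic curve `E = ℂ / (ℤ + ℤ η)`, as a group. -/
abbrev Curve (η : UpperHalfPlane) : Type := ℂ ⧸ lattice η

/-- The theta function of order one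
`θ(z) = ∑ₖ (-1)ᵏ exp(2πi (k z + k (k - 1) / 2 * η))`, an entire function with
`θ(z + 1) = θ(z)`, `θ(z + η) = -exp(-2πi z) θ(z)` and simple zeros exactly at `ℤ + ℤ η`.
It is Mathlib's two-variable theta function at a shifted argument. -/
def theta (η : UpperHalfPlane) (z : ℂ) : ℂ :=
  jacobiTheta₂ (z + 1 / 2 - (η : ℂ) / 2) (η : ℂ)

/-- The theta functions of order `n` of Odesskii and Feigin,
`θ_α(z) = exp(2πi (α z + α (α - n) / (2n) * η + α / (2n))) ∏_{s < n} θ(z + s / n + α η / n)`.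
They satisfy `θ_{α + n} = θ_α`, so they are indexed by `α ∈ ℤ / n`; the representative
`0 ≤ α < n` is used. -/
def thetaN (n : ℕ) (η : UpperHalfPlane) (α : ZMod n) (z : ℂ) : ℂ :=
  cexp (2 * Real.pi * I * ((α.val : ℂ) * z
      + (α.val : ℂ) * ((α.val : ℂ) - n) / (2 * n) * (η : ℂ) + (α.val : ℂ) / (2 * n)))
    * ∏ s ∈ Finset.range n, theta η (z + (s : ℂ) / n + (α.val : ℂ) * (η : ℂ) / n)

/-! ### Graded pieces -/

/-- If an algebra is generated by elements `gen s` of degree `wt s`, this is the piece of degree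
`d`: the span of all words of total degree `d` in the generators. -/
def gradedPiece {σ A : Type} [Ring A] [Algebra ℂ A] (gen : σ → A) (wt : σ → ℕ) (d : ℕ) :
    Submodule ℂ A :=
  Submodule.span ℂ {a | ∃ w : List σ, (w.map wt).sum = d ∧ a = (w.map gen).prod}

/-! ### Sklyanin algebras -/

/-- The variable `x_i` of the free algebra on `x_i`, `i ∈ ℤ / n`. -/
abbrev var {n : ℕ} (i : ZMod n) : FreeAlgebra ℂ (ZMod n) := FreeAlgebra.ι ℂ i

/-- The quadratic relation
`∑_{r ∈ ℤ/n} θ_{j-i}(0) / (θ_{j-i-r}(-τ) θ_r(τ)) x_{j-r} x_{i+r}`. -/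
def sklyaninRelator (n : ℕ) [NeZero n] (η : UpperHalfPlane) (τ : ℂ) (i j : ZMod n) :
    FreeAlgebra ℂ (ZMod n) :=
  ∑ r : ZMod n,
    (thetaN n η (j - i) 0 / (thetaN n η (j - i - r) (-τ) * thetaN n η r τ)) •
      (var (j - r) * var (i + r))

/-- The space of (quadratic) relations of `Q_{n,1}(E, τ)`. -/
def sklyaninRelations (n : ℕ) [NeZero n] (η : UpperHalfPlane) (τ : ℂ) :
    Submodule ℂ (FreeAlgebra ℂ (ZMod n)) :=
  Submodule.span ℂ {f | ∃ i j : ZMod n, i ≠ j ∧ f = sklyaninRelator n η τ i j}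

/-- The `n`-dimensional Sklyanin algebra `Q_{n,1}(E, τ)`, where `E = ℂ / (ℤ + ℤ η)` and the point
of `E` is given by a representative `τ : ℂ`. Replacing `τ` by another representative rescales the
relations, and all denominators are nonzero as soon as the point is not in `E[n]`. -/
abbrev Sklyanin (n : ℕ) [NeZero n] (η : UpperHalfPlane) (τ : ℂ) : Type :=
  RingQuot (fun f g : FreeAlgebra ℂ (ZMod n) => f ∈ sklyaninRelations n η τ ∧ g = 0)

/-- The generator `x_i` of the Sklyanin algebra. -/
def Sklyanin.x {n : ℕ} [NeZero n] {η : UpperHalfPlane} {τ : ℂ} (i : ZMod n) : Sklyanin n η τ :=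
  RingQuot.mkAlgHom ℂ _ (var i)

/-- The grading of the Sklyanin algebra, all generators having degree one. -/
def Sklyanin.grading (n : ℕ) [NeZero n] (η : UpperHalfPlane) (τ : ℂ) :
    ℕ → Submodule ℂ (Sklyanin n η τ) :=
  gradedPiece Sklyanin.x (fun _ => 1)

/-! ### Graded Clifford algebras -/

/-- The linear form `∑ₖ cₖ yₖ`, as an element of the free algebra on the symbols
`x_i = Sum.inl i` and `y_i = Sum.inr i`. -/
def linearForm {ι : Type} [Fintype ι] (f : MvPolynomial ι ℂ) : FreeAlgebra ℂ (ι ⊕ ι) :=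
  ∑ k : ι, f.coeff (Finsupp.single k 1) • FreeAlgebra.ι ℂ (Sum.inr k)

/-- The defining relations of the graded Clifford algebra of a matrix `M` of linear forms in the
`y_k`: `x_i x_j + x_j x_i = M_{ij}`, `[x_i, y_j] = 0`, `[y_i, y_j] = 0`. -/
inductive CliffordRel {ι : Type} [Fintype ι] (M : Matrix ι ι (MvPolynomial ι ℂ)) :
    FreeAlgebra ℂ (ι ⊕ ι) → FreeAlgebra ℂ (ι ⊕ ι) → Prop
  | anticomm (i j : ι) : CliffordRel M
      (FreeAlgebra.ι ℂ (Sum.inl i) * FreeAlgebra.ι ℂ (Sum.inl j)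
        + FreeAlgebra.ι ℂ (Sum.inl j) * FreeAlgebra.ι ℂ (Sum.inl i))
      (linearForm (M i j))
  | comm_xy (i j : ι) : CliffordRel M
      (FreeAlgebra.ι ℂ (Sum.inl i) * FreeAlgebra.ι ℂ (Sum.inr j))
      (FreeAlgebra.ι ℂ (Sum.inr j) * FreeAlgebra.ι ℂ (Sum.inl i))
  | comm_yy (i j : ι) : CliffordRel M
      (FreeAlgebra.ι ℂ (Sum.inr i) * FreeAlgebra.ι ℂ (Sum.inr j))
      (FreeAlgebra.ι ℂ (Sum.inr j) * FreeAlgebra.ι ℂ (Sum.inr i))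

/-- The algebra `A(M)` generated by the `x_i` and the `y_i` with the relations above. -/
abbrev CliffordAlg {ι : Type} [Fintype ι] (M : Matrix ι ι (MvPolynomial ι ℂ)) : Type :=
  RingQuot (CliffordRel M)

/-- The grading of `A(M)` with `deg x_i = 1` and `deg y_i = 2`. -/
def CliffordAlg.grading {ι : Type} [Fintype ι] (M : Matrix ι ι (MvPolynomial ι ℂ)) :
    ℕ → Submodule ℂ (CliffordAlg M) :=
  gradedPiece (fun s : ι ⊕ ι => RingQuot.mkAlgHom ℂ (CliffordRel M) (FreeAlgebra.ι ℂ s))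
    (Sum.elim (fun _ => 1) (fun _ => 2))

/-- An algebra `A` with graded pieces `𝒜 d` is a graded Clifford algebra (on generators indexed by
`ι`) if it is isomorphic, as a graded algebra, to `A(M)` for a symmetric matrix `M` of linear forms
in `ℂ[y_i : i ∈ ι]` with `det M ≠ 0`. As `y_i` has degree two, the linear forms are precisely the
elements of degree two. -/
def IsGradedClifford (ι : Type) [Fintype ι] [DecidableEq ι] {A : Type} [Ring A] [Algebra ℂ A]
    (𝒜 : ℕ → Submodule ℂ A) : Prop :=
  ∃ M : Matrix ι ι (MvPolynomial ι ℂ),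
    M.IsSymm ∧ (∀ i j, (M i j).IsHomogeneous 1) ∧ M.det ≠ 0 ∧
    ∃ φ : A ≃ₐ[ℂ] CliffordAlg M, ∀ d, (𝒜 d).map φ.toLinearMap = CliffordAlg.grading M d

/-! ### The Heisenberg group of order `p³` and its action -/

/-- Names of the generators of the Heisenberg group. -/
inductive HeisGen
  | e₁
  | e₂
  | z

/-- The relators of
`⟨e₁, e₂, z | e₁ᵖ = e₂ᵖ = zᵖ = 1, e₁ e₂ = z e₂ e₁, e₁ z = z e₁, e₂ z = z e₂⟩`. -/
inductive HeisRel (p : ℕ) : FreeGroup HeisGen → Prop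
  | e₁_pow : HeisRel p (FreeGroup.of .e₁ ^ p)
  | e₂_pow : HeisRel p (FreeGroup.of .e₂ ^ p)
  | z_pow : HeisRel p (FreeGroup.of .z ^ p)
  | e₁_e₂ : HeisRel p ((FreeGroup.of .e₁ * FreeGroup.of .e₂) *
      (FreeGroup.of .z * FreeGroup.of .e₂ * FreeGroup.of .e₁)⁻¹)
  | e₁_z : HeisRel p ((FreeGroup.of .e₁ * FreeGroup.of .z) *
      (FreeGroup.of .z * FreeGroup.of .e₁)⁻¹)
  | e₂_z : HeisRel p ((FreeGroup.of .e₂ * FreeGroup.of .z) *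
      (FreeGroup.of .z * FreeGroup.of .e₂)⁻¹)

/-- The Heisenberg group `H_p`. -/
abbrev Heis (p : ℕ) : Type := PresentedGroup {w | HeisRel p w}

/-- The generator `e₁` of `H_p`. -/
def Heis.e₁ (p : ℕ) : Heis p := PresentedGroup.of .e₁

/-- The algebra endomorphism `x_i ↦ c_i x_{i + a}` of the free algebra. -/
def monomialHom {p : ℕ} (c : ZMod p → ℂ) (a : ZMod p) :
    FreeAlgebra ℂ (ZMod p) →ₐ[ℂ] FreeAlgebra ℂ (ZMod p) :=
  FreeAlgebra.lift ℂ (fun i => c i • var (i + a))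

theorem monomialHom_var {p : ℕ} (c : ZMod p → ℂ) (a i : ZMod p) :
    monomialHom c a (var i) = c i • var (i + a) := by
  simp [monomialHom, var]

/-- The algebra automorphism `x_i ↦ x_{i-1}` of the free algebra. -/
def actE₁ (p : ℕ) : FreeAlgebra ℂ (ZMod p) ≃ₐ[ℂ] FreeAlgebra ℂ (ZMod p) :=
  AlgEquiv.ofAlgHom (monomialHom (fun _ => 1) (-1)) (monomialHom (fun _ => 1) 1)
    (by ext i; simp [monomialHom]) (by ext i; simp [monomialHom])

/-- The algebra automorphism `x_i ↦ ωⁱ x_i` of the free algebra, with `ω = exp(2πi / p)`. -/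
def actE₂ (p : ℕ) [NeZero p] : FreeAlgebra ℂ (ZMod p) ≃ₐ[ℂ] FreeAlgebra ℂ (ZMod p) :=
  AlgEquiv.ofAlgHom (monomialHom (fun i => ZMod.stdAddChar i) 0)
    (monomialHom (fun i => ZMod.stdAddChar (-i)) 0)
    (by
      ext i
      simp [monomialHom, smul_smul, ← AddChar.map_add_eq_mul])
    (by
      ext i
      simp [monomialHom, smul_smul, ← AddChar.map_add_eq_mul])

/-- The algebra automorphism `x_i ↦ ω x_i` of the free algebra, with `ω = exp(2πi / p)`. -/
def actZ (p : ℕ) [NeZero p] : FreeAlgebra ℂ (ZMod p) ≃ₐ[ℂ] FreeAlgebra ℂ (ZMod p) :=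
  AlgEquiv.ofAlgHom (monomialHom (fun _ => ZMod.stdAddChar (1 : ZMod p)) 0)
    (monomialHom (fun _ => ZMod.stdAddChar (-1 : ZMod p)) 0)
    (by
      ext i
      simp [monomialHom, smul_smul, ← AddChar.map_add_eq_mul])
    (by
      ext i
      simp [monomialHom, smul_smul, ← AddChar.map_add_eq_mul])

theorem actE₁_var (p : ℕ) (i : ZMod p) : actE₁ p (var i) = var (i - 1) := by
  simp [actE₁, monomialHom, var, sub_eq_add_neg]

theorem actE₂_var (p : ℕ) [NeZero p] (i : ZMod p) :
    actE₂ p (var i) = (ZMod.stdAddChar i : ℂ) • var i := by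
  simp [actE₂, monomialHom, var]

theorem actZ_var (p : ℕ) [NeZero p] (i : ZMod p) :
    actZ p (var i) = (ZMod.stdAddChar (1 : ZMod p) : ℂ) • var i := by
  simp [actZ, monomialHom, var]

theorem actE₁_pow_var (p : ℕ) (k : ℕ) (i : ZMod p) :
    (actE₁ p ^ k) (var i) = var (i - (k : ZMod p)) := by
  induction k with
  | zero => simp
  | succ k ih =>
    rw [pow_succ', AlgEquiv.mul_apply, ih, actE₁_var]
    congr 1
    push_cast
    ring

theorem actE₂_pow_var (p : ℕ) [NeZero p] (k : ℕ) (i : ZMod p) :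
    (actE₂ p ^ k) (var i) = (ZMod.stdAddChar ((k : ZMod p) * i) : ℂ) • var i := by
  induction k with
  | zero => simp
  | succ k ih =>
    rw [pow_succ', AlgEquiv.mul_apply, ih, map_smul, actE₂_var, smul_smul,
      ← AddChar.map_add_eq_mul]
    congr 2
    push_cast
    ring

theorem actZ_pow_var (p : ℕ) [NeZero p] (k : ℕ) (i : ZMod p) :
    (actZ p ^ k) (var i) = (ZMod.stdAddChar (k : ZMod p) : ℂ) • var i := by
  induction k with
  | zero => simp
  | succ k ih =>
    rw [pow_succ', AlgEquiv.mul_apply, ih, map_smul, actZ_var, smul_smul,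
      ← AddChar.map_add_eq_mul]
    congr 2
    push_cast
    ring

theorem algEquiv_ext_var {p : ℕ} {f g : FreeAlgebra ℂ (ZMod p) ≃ₐ[ℂ] FreeAlgebra ℂ (ZMod p)}
    (h : ∀ i, f (var i) = g (var i)) : f = g := by
  have : (f : FreeAlgebra ℂ (ZMod p) →ₐ[ℂ] FreeAlgebra ℂ (ZMod p)) = g := by
    ext i
    exact h i
  ext x
  exact DFunLike.congr_fun this x

/-- The action on the generators of `H_p`. -/
def heisGenAct (p : ℕ) [NeZero p] :
    HeisGen → (FreeAlgebra ℂ (ZMod p) ≃ₐ[ℂ] FreeAlgebra ℂ (ZMod p))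
  | .e₁ => actE₁ p
  | .e₂ => actE₂ p
  | .z => actZ p

theorem heisGenAct_rel (p : ℕ) [NeZero p] :
    ∀ w ∈ {w | HeisRel p w}, FreeGroup.lift (heisGenAct p) w = 1 := by
  rintro w (_ | _ | _ | _ | _ | _)
  · refine algEquiv_ext_var fun i => ?_
    simp [heisGenAct, actE₁_pow_var]
  · refine algEquiv_ext_var fun i => ?_
    simp [heisGenAct, actE₂_pow_var]
  · refine algEquiv_ext_var fun i => ?_
    simp [heisGenAct, actZ_pow_var]
  · rw [map_mul, map_inv, mul_inv_eq_one]
    refine algEquiv_ext_var fun i => ?_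
    simp [heisGenAct, AlgEquiv.mul_apply, actE₁_var, actE₂_var, actZ_var, smul_smul,
      ← AddChar.map_add_eq_mul]
  · rw [map_mul, map_inv, mul_inv_eq_one]
    refine algEquiv_ext_var fun i => ?_
    simp [heisGenAct, AlgEquiv.mul_apply, actE₁_var, actZ_var]
  · rw [map_mul, map_inv, mul_inv_eq_one]
    refine algEquiv_ext_var fun i => ?_
    simp [heisGenAct, AlgEquiv.mul_apply, actE₂_var, actZ_var, smul_smul, mul_comm]

/-- The action of `H_p` on the free algebra `T(V)` by graded algebra automorphisms, where
`V = ⨁ ℂ x_i` is the simple representation `e₁ x_i = x_{i-1}`, `e₂ x_i = ωⁱ x_i`, `z x_i = ω x_i`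
with `ω = exp(2πi / p)`. -/
def heisAct (p : ℕ) [NeZero p] :
    Heis p →* (FreeAlgebra ℂ (ZMod p) ≃ₐ[ℂ] FreeAlgebra ℂ (ZMod p)) :=
  PresentedGroup.toGroup (heisGenAct_rel p)

/-- The element `{x_i, x_{-i}} + a x_0²`, where `{u, v} = u v + v u`. -/
def anticommRelator (p : ℕ) (a : ℂ) (i : ZMod p) : FreeAlgebra ℂ (ZMod p) :=
  var i * var (-i) + var (-i) * var i + a • var 0 ^ 2

end SklyaninClifford

end

noncomputable section

namespace SklyaninClifford

open Complex

/-! Everything rests on counting: an entire function with period `1/p` and a quasi-periodicity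
factor of degree two lies in a space of dimension at most two, so one zero determines it up to a
scalar (`exists_eq_mul_of_zero`).

At a half period, `θ_{-α}(τ) = θ_α(τ)` while `θ_{-α}(0) = -θ_α(0)`. Hence the symmetrization of
`θ_d(z) θ_{-d}(z+τ)` vanishes at `0` and equals `2 φ_d θ_0(z) θ_0(z+τ)`; this defines the numbers
`φ_d` (`IsHalfPeriod.exists_coefficients`).

Centred at `c = (i+j)/2`, a Sklyanin relation has coefficients `1/(θ_{k+m}(τ) θ_{k-m}(τ))` on
`x_{c+m} x_{c-m}`. They are even in `m` and orthogonal to `φ`, so the relation is a combination of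
the elements `{x_{c+d}, x_{c-d}} - 2 φ_d x_c²`. The converse is a rank statement: for `k` and `m` in
a half system of residues the coefficients form a Cauchy matrix up to row and column scaling
(`IsHalfPeriod.eq_zero_of_sum_eq_zero`). So `a_i = -2 φ_i`, and the powers of `e₁` move the centre
`c`.

It remains to see that the squares `x_c²` are central. The relations give `(∑ z_i x_i)² = ∑_c q_c(z)
x_c²` with `q_c(z) = ∑_d φ_d z_{c+d} z_{c-d}`. If only `q_0(z)` is nonzero, then `x_0²` commutes
with `∑ z_i x_i`; twisting `z` by characters separates the summands (`commute_mul_self`). To find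
such `z`, expand `f = ∑ z_α θ_α`: then `f(x) f(x+τ) = ∑_c q_c(z) θ_c(x) θ_c(x+τ)`, so `f` may be any
theta function of order `p` for which this product is a nonzero multiple of `θ_0(x) θ_0(x+τ)`.
Translating two zeros of `θ_0` by `τ` produces one with `z_β ≠ 0` for all `β ≠ 0`
(`IsHalfPeriod.exists_quadForm_eq_zero`).

With `y_c = x_c²` the algebra is `A(M)` for `M_{ij} = 2 φ_{(i-j)/2} y_{(i+j)/2}`, whose determinant
is nonzero because no `φ_d` vanishes. -/

/-- The normalized exponential `exp(2πi z)`. -/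
def e (z : ℂ) : ℂ := cexp (2 * Real.pi * I * z)

theorem e_add (z w : ℂ) : e (z + w) = e z * e w := by
  simp [e, mul_add, Complex.exp_add]

theorem e_ne_zero (z : ℂ) : e z ≠ 0 := Complex.exp_ne_zero _

theorem e_zero : e 0 = 1 := by simp [e]

theorem e_neg (z : ℂ) : e (-z) = (e z)⁻¹ := by simp [e, Complex.exp_neg]

theorem e_sub (z w : ℂ) : e (z - w) = e z / e w := by
  rw [sub_eq_add_neg, e_add, e_neg, div_eq_mul_inv]

theorem e_int (n : ℤ) : e n = 1 := by
  rw [e, mul_comm]; exact Complex.exp_int_mul_two_pi_mul_I n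

theorem e_one : e 1 = 1 := by simpa using e_int 1

theorem e_eq_one_iff (z : ℂ) : e z = 1 ↔ ∃ n : ℤ, z = n := by
  rw [e, Complex.exp_eq_one_iff]
  refine exists_congr fun n => ?_
  rw [mul_comm, mul_left_inj' two_pi_I_ne_zero]

theorem e_half : e (1 / 2) = -1 := by
  rw [e, ← Complex.exp_pi_mul_I]; congr 1; ring

theorem differentiable_e : Differentiable ℂ e := by unfold e; fun_prop

/-! ### Fourier coefficients and dimension bounds for quasi-periodic entire functions -/

theorem integral_shift_of_periodic {F : ℂ → ℂ} (hF : Differentiable ℂ F)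
    (h1 : ∀ z, F (z + 1) = F z) (w : ℂ) :
    ∫ x in (0 : ℝ)..1, F (x + w) = ∫ x in (0 : ℝ)..1, F x := by
  -- Cauchy's theorem moves the segment vertically, the two vertical sides cancelling by
  -- periodicity; the horizontal part of the shift is absorbed by periodicity as well.
  have hrect := Complex.integral_boundary_rect_eq_zero_of_differentiableOn F 0 (1 + w.im * I)
    hF.differentiableOn
  have hv : ∀ y : ℝ, F (1 + y * I) = F (y * I) := fun y => by rw [add_comm, h1]
  simp only [zero_re, zero_im, add_re, one_re, mul_re, ofReal_re, I_re, mul_zero, ofReal_im, I_im,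
    mul_one, sub_self, add_zero, add_im, one_im, mul_im, zero_add, ofReal_zero, zero_mul,
    ofReal_one, hv, add_sub_cancel_right, sub_eq_zero] at hrect
  rw [hrect]
  have hper : Function.Periodic (fun x : ℝ => F (x + w.im * I)) 1 := fun x => by
    simp only [ofReal_add, ofReal_one]
    exact (congrArg F (by ring)).trans (h1 _)
  have := hper.intervalIntegral_add_eq w.re 0
  rw [zero_add] at this
  have hshift := intervalIntegral.integral_comp_add_right (a := 0) (b := 1)
    (fun x : ℝ => F (x + w.im * I)) w.re
  rw [zero_add, add_comm 1] at hshift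
  rw [← this, ← hshift]
  congr 1; ext x
  congr 1
  push_cast
  rw [add_assoc, re_add_im]

/-- The `k`-th Fourier coefficient of the restriction of a function to the real line. -/
def fcoeff (h : ℂ → ℂ) (k : ℤ) : ℂ := ∫ x in (0 : ℝ)..1, h x * e (-k * x)

/-- Moving the contour of the `k`-th coefficient by the quasi-period `T` turns the automorphy factor
into a shift of the frequency by `d`. -/
theorem fcoeff_add_degree {h : ℂ → ℂ} (hd : Differentiable ℂ h) (h1 : ∀ z, h (z + 1) = h z)
    {T C : ℂ} {d : ℕ} (h2 : ∀ z, h (z + T) = C * e (-d * z) * h z) (k : ℤ) :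
    C * e (-k * T) * fcoeff h (k + d) = fcoeff h k := by
  have := integral_shift_of_periodic (F := fun z => h z * e (-k * z))
    (hd.mul (differentiable_e.comp (by fun_prop))) (fun z => by
      simp only [h1]
      rw [mul_add, e_add, mul_one, ← Int.cast_neg, e_int, mul_one]) T
  rw [fcoeff, fcoeff, ← this, ← intervalIntegral.integral_const_mul]
  congr 1; ext x
  rw [h2]
  have : e (-↑(k + (d : ℤ)) * ↑x) = e (-k * x) * e (-d * x) := by
    rw [← e_add]; congr 1; push_cast; ring
  rw [this, mul_add, e_add]; ring

/-- The Fourier series is trivially summable, so the function vanishes on the real line, and then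
everywhere by the identity theorem. -/
theorem eq_zero_of_fcoeff_eq_zero {h : ℂ → ℂ} (hd : Differentiable ℂ h)
    (h1 : ∀ z, h (z + 1) = h z) (hc : ∀ k, fcoeff h k = 0) : h = 0 := by
  have : Fact ((0 : ℝ) < 1) := ⟨one_pos⟩
  have hper : Function.Periodic (fun x : ℝ => h x) 1 := fun x => by
    simp only [ofReal_add, ofReal_one, h1]
  have hcont : Continuous hper.lift := by
    refine continuous_coinduced_dom.mpr ?_
    exact hd.continuous.comp continuous_ofReal
  let f : C(AddCircle (1 : ℝ), ℂ) := ⟨hper.lift, hcont⟩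
  have hf : ∀ x : ℝ, f x = h x := fun x => rfl
  have hz : fourierCoeff f = 0 := by
    ext k
    rw [fourierCoeff_eq_intervalIntegral _ k 0]
    simp only [hf, zero_add, Pi.zero_apply, div_one, one_smul]
    rw [← hc k, fcoeff]
    congr 1; ext x
    rw [smul_eq_mul, mul_comm, e, fourier_coe_apply]
    congr 2
    push_cast
    ring
  have hreal : ∀ x : ℝ, h x = 0 := fun x => by
    have := has_pointwise_sum_fourier_series_of_summable (f := f) (by rw [hz]; exact summable_zero) x
    rw [hz] at this
    simp only [Pi.zero_apply, zero_smul] at this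
    exact (hf x).symm.trans (this.unique hasSum_zero)
  have han : AnalyticOnNhd ℂ h Set.univ := fun z _ => hd.analyticAt z
  refine han.eq_of_frequently_eq (g := 0) (fun z _ => analyticAt_const) (z₀ := 0) ?_
  have hseq : Filter.Tendsto (fun n : ℕ => ((1 / ((n : ℝ) + 1) : ℝ) : ℂ)) Filter.atTop
      (nhdsWithin 0 {0}ᶜ) := by
    refine tendsto_nhdsWithin_iff.mpr ⟨?_, Filter.Eventually.of_forall fun n => ?_⟩
    · have := (continuous_ofReal.tendsto 0).comp tendsto_one_div_add_atTop_nhds_zero_nat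
      simpa [Function.comp_def] using this
    · simp only [Set.mem_compl_iff, Set.mem_singleton_iff, ofReal_eq_zero]
      positivity
  exact hseq.frequently (Filter.Frequently.of_forall fun n => hreal _)

/-- The recurrence with step `d` has nonzero factors, so `d` consecutive coefficients determine all
of them. -/
theorem eq_zero_of_fcoeff_lt {h : ℂ → ℂ} (hd : Differentiable ℂ h) (h1 : ∀ z, h (z + 1) = h z)
    {T C : ℂ} {d : ℕ} (hC : C ≠ 0) (h2 : ∀ z, h (z + T) = C * e (-d * z) * h z) (hd0 : 0 < d)
    (hc : ∀ k : Fin d, fcoeff h k = 0) : h = 0 := by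
  refine eq_zero_of_fcoeff_eq_zero hd h1 fun k => ?_
  have hstep : ∀ k : ℤ, fcoeff h (k + d) = 0 ↔ fcoeff h k = 0 := fun k => by
    rw [← fcoeff_add_degree hd h1 h2 k]
    simp [hC, e_ne_zero]
  have hall : ∀ (n : ℤ) (k : ℤ), fcoeff h (k + n * d) = 0 ↔ fcoeff h k = 0 := by
    intro n
    induction n using Int.induction_on with
    | zero => simp
    | succ n ih =>
      intro k
      rw [show k + (n + 1 : ℤ) * d = k + n * d + d by ring, hstep, ih]
    | pred n ih =>
      intro k
      rw [← hstep, show k + (-n - 1 : ℤ) * d + d = k + -n * d by ring, ih]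
  have hk : k = k % d + (k / d) * d := by rw [mul_comm]; exact (Int.emod_add_mul_ediv k d).symm
  rw [hk, hall]
  have h0 : 0 ≤ k % (d : ℤ) := Int.emod_nonneg _ (by omega)
  have h3 : k % (d : ℤ) < d := Int.emod_lt_of_pos _ (by omega)
  have := hc ⟨(k % d).toNat, by omega⟩
  simpa [Int.toNat_of_nonneg h0] using this

/-- Entire functions of period `1 / r` with factor of automorphy `C exp(-2πi d r z)` for the
period `T`. -/
def thetaSpace (r : ℕ) (T : ℂ) (d : ℕ) (C : ℂ) : Submodule ℂ (ℂ → ℂ) where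
  carrier := {h | Differentiable ℂ h ∧ (∀ z, h (z + 1 / r) = h z) ∧
    ∀ z, h (z + T) = C * e (-d * (r * z)) * h z}
  zero_mem' := ⟨differentiable_const 0, by simp, by simp⟩
  add_mem' := fun {f g} hf hg => ⟨hf.1.add hg.1, fun z => by
    simp only [Pi.add_apply, hf.2.1, hg.2.1], fun z => by
    simp only [Pi.add_apply, hf.2.2, hg.2.2]; ring⟩
  smul_mem' := fun c f hf => ⟨hf.1.const_smul c, fun z => by
    simp only [Pi.smul_apply, hf.2.1], fun z => by
    simp only [Pi.smul_apply, hf.2.2, smul_eq_mul]; ring⟩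

/-- Rescaling by `r` reduces to period `1` and quasi-period `r T`; the map then reads off the first
`d` Fourier coefficients. -/
theorem exists_injective_thetaSpace {r : ℕ} (hr : r ≠ 0) (T : ℂ) {d : ℕ} (hd : 0 < d) {C : ℂ}
    (hC : C ≠ 0) : ∃ L : thetaSpace r T d C →ₗ[ℂ] (Fin d → ℂ), Function.Injective L := by
  have hr' : (r : ℂ) ≠ 0 := Nat.cast_ne_zero.mpr hr
  have hint : ∀ (h : thetaSpace r T d C) (k : ℤ), IntervalIntegrable
      (fun x : ℝ => h.1 ((x : ℂ) / r) * e (-k * x)) MeasureTheory.volume 0 1 := fun h k => by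
    refine Continuous.intervalIntegrable ?_ _ _
    refine (h.2.1.continuous.comp (by fun_prop)).mul (differentiable_e.continuous.comp (by fun_prop))
  refine ⟨{ toFun := fun h k => fcoeff (fun z => h.1 (z / r)) k
            map_add' := fun f g => ?_
            map_smul' := fun c f => ?_ }, ?_⟩
  · ext k
    simp only [fcoeff, Pi.add_apply, Submodule.coe_add]
    rw [← intervalIntegral.integral_add (hint f k) (hint g k)]
    simp only [add_mul]
  · ext k
    simp only [fcoeff, Pi.smul_apply, Submodule.coe_smul, smul_eq_mul, RingHom.id_apply]
    rw [← intervalIntegral.integral_const_mul]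
    simp only [mul_assoc]
  · rw [injective_iff_map_eq_zero]
    intro h hh
    have hz : (fun z => h.1 (z / r)) = 0 := by
      refine eq_zero_of_fcoeff_lt (T := r * T) (C := C) (d := d)
        (h.2.1.comp (by fun_prop)) (fun z => ?_) hC (fun z => ?_) hd (fun k => congrFun hh k)
      · rw [add_div, h.2.2.1]
      · rw [add_div, mul_div_cancel_left₀ _ hr', h.2.2.2, mul_div_cancel₀ _ hr']
    ext z
    have := congrFun hz (r * z)
    simpa [mul_div_cancel_left₀ _ hr'] using this

theorem finite_thetaSpace {r : ℕ} (hr : r ≠ 0) (T : ℂ) {d : ℕ} (hd : 0 < d) {C : ℂ}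
    (hC : C ≠ 0) : Module.Finite ℂ (thetaSpace r T d C) := by
  obtain ⟨L, hL⟩ := exists_injective_thetaSpace hr T hd hC
  exact Module.Finite.of_injective L hL

theorem finrank_thetaSpace_le {r : ℕ} (hr : r ≠ 0) (T : ℂ) {d : ℕ} (hd : 0 < d) {C : ℂ}
    (hC : C ≠ 0) : Module.finrank ℂ (thetaSpace r T d C) ≤ d := by
  obtain ⟨L, hL⟩ := exists_injective_thetaSpace hr T hd hC
  simpa using LinearMap.finrank_le_finrank_of_injective hL

/-! ### The zeros of theta, by comparison with the Jacobi product -/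

/-- The `q`-Pochhammer symbol `(u; q)_∞`. -/
def qPoch (q u : ℂ) : ℂ := ∏' k : ℕ, (1 - q ^ k * u)

theorem summable_qPoch {q : ℂ} (hq : ‖q‖ < 1) (u : ℂ) : Summable fun k : ℕ => ‖-(q ^ k * u)‖ := by
  simp only [norm_neg, norm_mul, norm_pow]
  exact (summable_geometric_of_lt_one (norm_nonneg _) hq).mul_right _

theorem multipliable_qPoch {q : ℂ} (hq : ‖q‖ < 1) (u : ℂ) :
    Multipliable fun k : ℕ => 1 - q ^ k * u := by
  simpa [sub_eq_add_neg] using multipliable_one_add_of_summable (summable_qPoch hq u)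

theorem qPoch_eq_mul {q : ℂ} (hq : ‖q‖ < 1) (u : ℂ) : qPoch q u = (1 - u) * qPoch q (q * u) := by
  have h1 : ∀ k : ℕ, 1 - q ^ k * (q * u) = 1 - q ^ (k + 1) * u := fun k => by ring
  have h2 : Multipliable fun k : ℕ => 1 - q ^ (k + 1) * u :=
    (multipliable_qPoch hq (q * u)).congr h1
  have h3 := tprod_eq_zero_mul' (f := fun k : ℕ => 1 - q ^ k * u) h2
  rw [qPoch, h3, qPoch, tprod_congr h1, pow_zero, one_mul]

theorem qPoch_ne_zero {q : ℂ} (hq : ‖q‖ < 1) {u : ℂ} (hu : ∀ k : ℕ, q ^ k * u ≠ 1) :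
    qPoch q u ≠ 0 := by
  have := tprod_one_add_ne_zero_of_summable (f := fun k : ℕ => -(q ^ k * u))
    (fun k => by simpa [← sub_eq_add_neg, sub_eq_zero] using (hu k).symm) (summable_qPoch hq u)
  simpa [qPoch, sub_eq_add_neg] using this

theorem differentiable_qPoch {q : ℂ} (hq : ‖q‖ < 1) : Differentiable ℂ (qPoch q) := by
  intro u
  have hloc : HasProdLocallyUniformlyOn (fun (k : ℕ) u => 1 + -(q ^ k * u))
      (fun u => ∏' k : ℕ, (1 + -(q ^ k * u))) (Metric.ball (0 : ℂ) (‖u‖ + 1)) := by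
    refine ((summable_geometric_of_lt_one (norm_nonneg _) hq).mul_right
      (‖u‖ + 1)).hasProdLocallyUniformlyOn_nat_one_add Metric.isOpen_ball
      (.of_forall fun n x hx => ?_) (fun _ => by fun_prop)
    rw [norm_neg, norm_mul, norm_pow]
    gcongr
    exact (mem_ball_zero_iff.mp hx).le
  have := TendstoLocallyUniformlyOn.differentiableOn hloc
    (.of_forall fun s => by
      simpa [Finset.prod_fn] using DifferentiableOn.finsetProd (fun _ _ => by fun_prop))
    Metric.isOpen_ball
  simp only [← sub_eq_add_neg] at this
  exact this.differentiableAt (Metric.isOpen_ball.mem_nhds (by simp))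

theorem norm_e_lt_one (η : UpperHalfPlane) : ‖e η‖ < 1 := UpperHalfPlane.norm_exp_two_pi_I_lt_one η

/-- The product `∏ (1 - qᵏ x) (1 - qᵏ⁺¹ / x)` at `x = exp(2πi z)`, `q = exp(2πi η)`. -/
def thetaProd (η : UpperHalfPlane) (z : ℂ) : ℂ := qPoch (e η) (e z) * qPoch (e η) (e η * e (-z))

theorem thetaProd_add_one (η : UpperHalfPlane) (z : ℂ) : thetaProd η (z + 1) = thetaProd η z := by
  simp [thetaProd, e_add, e_one, e_neg]

theorem thetaProd_add (η : UpperHalfPlane) (z : ℂ) :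
    thetaProd η (z + η) = -e (-z) * thetaProd η z := by
  have h1 := qPoch_eq_mul (norm_e_lt_one η) (e z)
  have h2 := qPoch_eq_mul (norm_e_lt_one η) (e (-z))
  have h3 : e η * e (-(z + η)) = e (-z) := by rw [← e_add]; congr 1; ring
  have h4 : e z * e (-z) = 1 := by rw [← e_add, add_neg_cancel, e_zero]
  rw [thetaProd, thetaProd, h3, h2, h1, e_add, mul_comm (e z)]
  linear_combination -qPoch (e ↑η) (e ↑η * e z) * qPoch (e ↑η) (e ↑η * e (-z)) * h4

theorem mem_lattice_iff (η : UpperHalfPlane) (z : ℂ) :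
    z ∈ lattice η ↔ ∃ m n : ℤ, z = m + n * η := by
  simp [lattice, AddSubgroup.mem_closure_pair, eq_comm]

/-- Zeros are visible factor by factor in a convergent product, which is why the product is
introduced next to the series. -/
theorem thetaProd_ne_zero (η : UpperHalfPlane) {z : ℂ} (hz : z ∉ lattice η) :
    thetaProd η z ≠ 0 := by
  have hpow : ∀ k : ℕ, e η ^ k = e (k * η) := fun k => by
    induction k with
    | zero => simp [e_zero]
    | succ k ih => rw [pow_succ, ih, ← e_add]; congr 1; push_cast; ring
  refine mul_ne_zero (qPoch_ne_zero (norm_e_lt_one η) fun k hk => hz ?_)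
    (qPoch_ne_zero (norm_e_lt_one η) fun k hk => hz ?_)
  · rw [hpow, ← e_add, e_eq_one_iff] at hk
    obtain ⟨n, hn⟩ := hk
    refine (mem_lattice_iff η z).mpr ⟨n, -k, ?_⟩
    push_cast
    linear_combination hn
  · rw [hpow, ← e_add, ← e_add, e_eq_one_iff] at hk
    obtain ⟨n, hn⟩ := hk
    refine (mem_lattice_iff η z).mpr ⟨-n, k + 1, ?_⟩
    push_cast
    linear_combination -hn

theorem differentiable_thetaProd (η : UpperHalfPlane) : Differentiable ℂ (thetaProd η) := by
  have h := differentiable_qPoch (norm_e_lt_one η)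
  have he := differentiable_e
  unfold thetaProd
  exact (h.comp he).mul (h.comp ((differentiable_const _).mul (he.comp differentiable_neg)))

theorem differentiable_theta (η : UpperHalfPlane) : Differentiable ℂ (theta η) := fun z =>
  (differentiableAt_jacobiTheta₂_fst _ η.im_pos).comp z (by fun_prop)

theorem theta_add_one (η : UpperHalfPlane) (z : ℂ) : theta η (z + 1) = theta η z := by
  rw [theta, theta, ← jacobiTheta₂_add_left (z + 1 / 2 - η / 2)]; congr 1; ring

theorem theta_add (η : UpperHalfPlane) (z : ℂ) : theta η (z + η) = -e (-z) * theta η z := by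
  rw [theta, show z + η + 1 / 2 - (η : ℂ) / 2 = z + 1 / 2 - η / 2 + η by ring,
    jacobiTheta₂_add_left', theta]
  congr 1
  rw [neg_eq_neg_one_mul (e _), ← e_half, e, e, ← Complex.exp_add, Complex.exp_eq_exp_iff_exists_int]
  exact ⟨-1, by push_cast; ring⟩

theorem theta_neg (η : UpperHalfPlane) (z : ℂ) : theta η (-z) = -e (-z) * theta η z := by
  rw [theta, ← jacobiTheta₂_neg_left,
    show -(-z + 1 / 2 - (η : ℂ) / 2) = z + 1 / 2 - η / 2 - 1 + η by ring,
    jacobiTheta₂_add_left', theta, ← jacobiTheta₂_add_left (z + 1 / 2 - η / 2 - 1), sub_add_cancel]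
  congr 1
  rw [neg_eq_neg_one_mul (e _), ← e_half, e, e, ← Complex.exp_add]
  congr 1
  ring

theorem theta_mem (η : UpperHalfPlane) : theta η ∈ thetaSpace 1 η 1 (-1) :=
  ⟨differentiable_theta η, fun z => by simpa using theta_add_one η z, fun z => by
    simpa using theta_add η z⟩

theorem thetaProd_mem (η : UpperHalfPlane) : thetaProd η ∈ thetaSpace 1 η 1 (-1) :=
  ⟨differentiable_thetaProd η, fun z => by simpa using thetaProd_add_one η z, fun z => by
    simpa using thetaProd_add η z⟩

theorem half_notMem_lattice (η : UpperHalfPlane) : (1 / 2 : ℂ) ∉ lattice η := by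
  rw [mem_lattice_iff]
  rintro ⟨m, n, h⟩
  have him := congrArg Complex.im h
  have hn : (n : ℝ) = 0 := by simpa [UpperHalfPlane.ne_zero, η.im_ne_zero] using him.symm
  have hre := congrArg Complex.re h
  simp [hn] at hre
  have : (1 : ℝ) = (2 * m : ℤ) := by push_cast; linarith
  have : (1 : ℤ) = 2 * m := by exact_mod_cast this
  omega

/-- Only the term `n = 0` of the series survives integration over a period. This serves to show that
theta is not identically zero. -/
theorem integral_jacobiTheta₂ (η : UpperHalfPlane) :
    ∫ x in (0 : ℝ)..1, jacobiTheta₂ x η = 1 := by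
  have hterm : ∀ (n : ℤ) (x : ℝ), ‖jacobiTheta₂_term n x η‖ = ‖jacobiTheta₂_term n 0 η‖ :=
    fun n x => by simp [norm_jacobiTheta₂_term]
  have hsum := intervalIntegral.hasSum_integral_of_dominated_convergence
    (F := fun (n : ℤ) (x : ℝ) => jacobiTheta₂_term n x η) (f := fun x : ℝ => jacobiTheta₂ x η)
    (a := 0) (b := 1) (μ := MeasureTheory.volume)
    (fun n _ => ‖jacobiTheta₂_term n 0 η‖)
    (fun n => (Continuous.aestronglyMeasurable (by unfold jacobiTheta₂_term; fun_prop)))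
    (fun n => .of_forall fun x _ => (hterm n x).le)
    (.of_forall fun x _ => ((summable_jacobiTheta₂_term_iff 0 η).mpr η.im_pos).norm)
    (by simp)
    (.of_forall fun x _ => hasSum_jacobiTheta₂_term x η.im_pos)
  have hint : ∀ n : ℤ, ∫ x in (0 : ℝ)..1, jacobiTheta₂_term n x η = if n = 0 then 1 else 0 := by
    intro n
    split_ifs with hn
    · simp [hn, jacobiTheta₂_term]
    · have hc : (2 * Real.pi * I * n : ℂ) ≠ 0 :=
        mul_ne_zero two_pi_I_ne_zero (Int.cast_ne_zero.mpr hn)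
      have : ∀ x : ℝ, jacobiTheta₂_term n x η
          = cexp (Real.pi * I * n ^ 2 * η) * cexp (2 * Real.pi * I * n * x) := fun x => by
        rw [jacobiTheta₂_term, ← Complex.exp_add, add_comm]
      simp only [this, intervalIntegral.integral_const_mul]
      rw [integral_exp_mul_complex hc]
      have h1 : cexp (2 * Real.pi * I * n) = 1 := e_int n
      simp [h1]
  simp only [hint] at hsum
  exact hsum.unique (hasSum_ite_eq 0 1)

theorem theta_ne_zero (η : UpperHalfPlane) : theta η ≠ 0 := by
  intro h
  have := integral_jacobiTheta₂ η
  have hz : ∀ x : ℝ, jacobiTheta₂ x η = 0 := fun x => by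
    have := congrFun h (x - 1 / 2 + η / 2)
    rwa [theta, show (x - 1 / 2 + η / 2 + 1 / 2 - η / 2 : ℂ) = x by ring] at this
  simp [hz] at this

/-- Series and product lie in the same space of dimension at most one. This is the Jacobi triple
product up to the value of the constant, which is all that locating zeros requires. -/
theorem exists_theta_eq (η : UpperHalfPlane) : ∃ c : ℂ, c ≠ 0 ∧ ∀ z, theta η z = c * thetaProd η z := by
  have := finite_thetaSpace one_ne_zero (η : ℂ) one_pos (C := -1) (by norm_num)
  have hr := finrank_thetaSpace_le one_ne_zero (η : ℂ) one_pos (C := -1) (by norm_num)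
  let P : thetaSpace 1 η 1 (-1) := ⟨_, thetaProd_mem η⟩
  have hP : P ≠ 0 := fun h => thetaProd_ne_zero η (half_notMem_lattice η)
    (congrFun (congrArg Subtype.val h) (1 / 2))
  obtain ⟨c, hc⟩ := exists_smul_eq_of_finrank_eq_one
    (le_antisymm hr (Module.finrank_pos_iff_exists_ne_zero.mpr ⟨P, hP⟩)) hP ⟨_, theta_mem η⟩
  have hc' : ∀ z, theta η z = c * thetaProd η z := fun z =>
    (congrFun (congrArg Subtype.val hc) z).symm
  refine ⟨c, ?_, hc'⟩
  rintro rfl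
  exact theta_ne_zero η (funext fun z => by simp [hc'])

theorem theta_zero (η : UpperHalfPlane) : theta η 0 = 0 := by
  have h := theta_neg η 0
  rw [neg_zero, e_zero] at h
  linear_combination h / 2

theorem theta_eq_zero_iff (η : UpperHalfPlane) (z : ℂ) : theta η z = 0 ↔ z ∈ lattice η := by
  constructor
  · intro h
    by_contra hz
    obtain ⟨c, hc, hP⟩ := exists_theta_eq η
    exact mul_ne_zero hc (thetaProd_ne_zero η hz) ((hP z).symm.trans h)
  · rw [mem_lattice_iff]
    rintro ⟨m, n, rfl⟩
    have h1 : ∀ (m : ℤ) (z : ℂ), theta η (z + m) = theta η z := fun m z => by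
      simpa using (Function.Periodic.int_mul (theta_add_one η) m) z
    rw [add_comm, h1]
    have h2 : ∀ z, theta η (z + η) = 0 ↔ theta η z = 0 := fun z => by
      rw [theta_add]; simp [e_ne_zero]
    induction n using Int.induction_on with
    | zero => simp [theta_zero]
    | succ n ih =>
      rwa [show ((n + 1 : ℤ) : ℂ) * η = (n : ℤ) * η + η by push_cast; ring, h2]
    | pred n ih =>
      rwa [← h2, show ((-n - 1 : ℤ) : ℂ) * η + η = (-n : ℤ) * η by push_cast; ring]

/-! ### Theta functions of odd order -/

/-- The product of the translates of `θ` by the points of order dividing `p` on the real axis. -/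
def thetaPi (p : ℕ) (η : UpperHalfPlane) (z : ℂ) : ℂ :=
  ∏ s ∈ Finset.range p, theta η (z + (s : ℂ) / p)

/-- Theta functions of order `p` indexed by integers, normalized so that their parity is
`thetaInt_neg`. -/
def thetaInt (p : ℕ) (η : UpperHalfPlane) (a : ℤ) (z : ℂ) : ℂ :=
  e (a * z + a * (a - p) / (2 * p) * η + a / 2) * thetaPi p η (z + a * η / p)

/-- Theta functions of order `p` indexed by residue classes. -/
def thetaMod (p : ℕ) (η : UpperHalfPlane) (α : ZMod p) : ℂ → ℂ := thetaInt p η (α.val : ℤ)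

section

variable {p : ℕ} (η : UpperHalfPlane)

theorem differentiable_thetaPi : Differentiable ℂ (thetaPi p η) := by
  unfold thetaPi
  exact Differentiable.fun_finsetProd fun s _ => (differentiable_theta η).comp (by fun_prop)

theorem differentiable_thetaMod (α : ZMod p) : Differentiable ℂ (thetaMod p η α) :=
  (differentiable_e.comp (by fun_prop)).mul ((differentiable_thetaPi η).comp (by fun_prop))

theorem prod_e {ι : Type*} (s : Finset ι) (f : ι → ℂ) : ∏ i ∈ s, e (f i) = e (∑ i ∈ s, f i) := by
  classical
  induction s using Finset.induction_on with
  | empty => simp [e_zero]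
  | insert a s ha ih => rw [Finset.prod_insert ha, Finset.sum_insert ha, ih, e_add]

/-- The factor relating the translation by `c η / p` to the shift of the index by `c`. -/
def shiftFactor (p : ℕ) (η : UpperHalfPlane) (c : ℤ) (z : ℂ) : ℂ :=
  e (c * z + c * (c - p) / (2 * p) * η + c / 2)

theorem shiftFactor_ne_zero (c : ℤ) (z : ℂ) : shiftFactor p η c z ≠ 0 := e_ne_zero _

theorem thetaMod_zero (z : ℂ) : thetaMod p η 0 z = thetaPi p η z := by
  simp [thetaMod, thetaInt, e_zero]

variable [NeZero p]

theorem cast_ne_zero_of_neZero : (p : ℂ) ≠ 0 := Nat.cast_ne_zero.mpr (NeZero.ne p)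

theorem thetaPi_add_inv (z : ℂ) : thetaPi p η (z + 1 / p) = thetaPi p η z := by
  have hp := cast_ne_zero_of_neZero (p := p)
  obtain ⟨k, hk⟩ := Nat.exists_eq_succ_of_ne_zero (NeZero.ne p)
  have h1 : ∀ s : ℕ, theta η (z + 1 / p + (s : ℂ) / p) = theta η (z + ((s + 1 : ℕ) : ℂ) / p) :=
    fun s => by congr 1; push_cast; ring
  rw [thetaPi, thetaPi, Finset.prod_congr rfl fun s _ => h1 s]
  have h2 := Finset.prod_range_succ (fun s : ℕ => theta η (z + (s : ℂ) / p)) p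
  rw [Finset.prod_range_succ'] at h2
  have h3 : theta η (z + ((0 : ℕ) : ℂ) / p) = theta η (z + (p : ℂ) / p) := by
    rw [div_self hp, theta_add_one]; simp
  rw [h3] at h2
  -- The two products differ by a cyclic shift of factors, seen after multiplying by a common
  -- factor. Where that factor vanishes it cannot be cancelled, but then each product contains a
  -- zero.
  by_cases hz : theta η (z + (p : ℂ) / p) = 0
  · have hk0 : theta η (z + ((0 : ℕ) : ℂ) / p) = 0 := h3.trans hz
    rw [Finset.prod_eq_zero (i := k) (by simp [hk]), Finset.prod_eq_zero (i := 0) (by simp [hk]) hk0]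
    rw [← hz, hk]
  · exact mul_right_cancel₀ hz h2

theorem sum_range_div : ∑ s ∈ Finset.range p, (s : ℂ) / p = (p - 1) / 2 := by
  have hp := cast_ne_zero_of_neZero (p := p)
  rw [← Finset.sum_div, div_eq_div_iff hp two_ne_zero]
  have := Finset.sum_range_id_mul_two p
  have h2 : ((∑ i ∈ Finset.range p, i : ℕ) : ℂ) * 2 = p * (p - 1) := by
    rw [← Nat.cast_pred (Nat.pos_of_ne_zero (NeZero.ne p))]; exact_mod_cast this
  push_cast at h2
  rw [h2]; ring

/-- Oddness of `p` enters twice: the signs multiply to `-1`, and the sum `(p-1)/2` of the shifts is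
an integer. -/
theorem thetaPi_add (hp : Odd p) (z : ℂ) : thetaPi p η (z + η) = -e (-(p * z)) * thetaPi p η z := by
  obtain ⟨k, hk⟩ := id hp
  have h1 : ∀ s : ℕ, theta η (z + η + (s : ℂ) / p)
      = -1 * e (-z - (s : ℂ) / p) * theta η (z + (s : ℂ) / p) := fun s => by
    rw [show z + η + (s : ℂ) / p = z + (s : ℂ) / p + η by ring, theta_add, neg_add']; ring
  rw [thetaPi, thetaPi, Finset.prod_congr rfl fun s _ => h1 s, Finset.prod_mul_distrib,
    Finset.prod_mul_distrib, prod_e, Finset.sum_sub_distrib, sum_range_div]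
  simp only [Finset.prod_const, Finset.card_range, hp.neg_one_pow, Finset.sum_const,
    nsmul_eq_mul]
  rw [e_sub, show ((p : ℂ) - 1) / 2 = ((k : ℤ) : ℂ) by rw [hk]; push_cast; ring, e_int,
    mul_neg (p : ℂ)]
  ring

theorem prod_theta_sub (z : ℂ) :
    ∏ s ∈ Finset.range p, theta η (z - (s : ℂ) / p) = thetaPi p η z := by
  have hp0 := cast_ne_zero_of_neZero (p := p)
  rw [← thetaPi_add_inv, thetaPi, ← Finset.prod_range_reflect]
  refine Finset.prod_congr rfl fun s hs => ?_
  have hs' := Finset.mem_range.mp hs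
  rw [← theta_add_one, show p - 1 - s = p - (s + 1) by omega, Nat.cast_sub (by omega)]
  congr 1
  push_cast
  field_simp
  ring

theorem thetaPi_neg (hp : Odd p) (z : ℂ) : thetaPi p η (-z) = -e (-(p * z)) * thetaPi p η z := by
  obtain ⟨k, hk⟩ := id hp
  have hp0 := cast_ne_zero_of_neZero (p := p)
  have h1 : ∀ s : ℕ, theta η (-z + (s : ℂ) / p)
      = -1 * e (-z + (s : ℂ) / p) * theta η (z - (s : ℂ) / p) := fun s => by
    rw [show -z + (s : ℂ) / p = -(z - s / p) by ring, theta_neg]; ring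
  rw [thetaPi, Finset.prod_congr rfl fun s _ => h1 s, Finset.prod_mul_distrib,
    Finset.prod_mul_distrib, prod_e, Finset.sum_add_distrib, sum_range_div, prod_theta_sub]
  simp only [Finset.prod_const, Finset.card_range, hp.neg_one_pow, Finset.sum_const,
    nsmul_eq_mul]
  rw [e_add, show (((p : ℂ) - 1) / 2) = ((k : ℤ) : ℂ) by rw [hk]; push_cast; ring, e_int,
    mul_neg (p : ℂ)]
  ring

theorem thetaPi_eq_zero_iff (z : ℂ) :
    thetaPi p η z = 0 ↔ ∃ m n : ℤ, z = m / p + n * η := by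
  have hp0 := cast_ne_zero_of_neZero (p := p)
  simp only [thetaPi, Finset.prod_eq_zero_iff, theta_eq_zero_iff, mem_lattice_iff]
  constructor
  · rintro ⟨s, -, m, n, h⟩
    refine ⟨m * p - s, n, ?_⟩
    push_cast
    field_simp
    field_simp at h
    linear_combination h
  · rintro ⟨m, n, rfl⟩
    have h0 : 0 ≤ (-m) % (p : ℤ) := Int.emod_nonneg _ (by exact_mod_cast NeZero.ne p)
    have h3 : (-m) % (p : ℤ) < p := Int.emod_lt_of_pos _ (by have := NeZero.pos p; omega)
    refine ⟨((-m) % (p : ℤ)).toNat, by simp; omega, -((-m) / p), n, ?_⟩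
    have h4 := Int.emod_add_mul_ediv (-m) p
    rw [← Int.cast_natCast (R := ℂ) (Int.toNat _), Int.toNat_of_nonneg h0]
    have h5 : (((-m) % (p : ℤ) : ℤ) : ℂ) + p * (((-m) / (p : ℤ) : ℤ) : ℂ) = -m := by
      exact_mod_cast h4
    push_cast
    field_simp
    linear_combination h5

theorem thetaInt_add_self (hp : Odd p) (a : ℤ) (z : ℂ) :
    thetaInt p η (a + p) z = thetaInt p η a z := by
  have hp0 := cast_ne_zero_of_neZero (p := p)
  obtain ⟨k, hk⟩ := id hp
  have h1 : z + ((a + p : ℤ) : ℂ) * η / p = z + a * η / p + η := by push_cast; field_simp; ring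
  have h2 : ((a + p : ℤ) : ℂ) * z + (a + p : ℤ) * ((a + p : ℤ) - p) / (2 * p) * η + (a + p : ℤ) / 2
      = (a * z + a * (a - p) / (2 * p) * η + a / 2) + p * (z + a * η / p) + (k : ℤ) + 1 / 2 := by
    rw [add_assoc _ ((k : ℤ) : ℂ),
      show ((k : ℤ) : ℂ) + 1 / 2 = p / 2 by rw [hk]; push_cast; ring]
    push_cast; field_simp; ring
  rw [thetaInt, thetaInt, h1, h2, thetaPi_add η hp, e_add _ (1 / 2), e_half, e_add _ ((k : ℤ) : ℂ),
    e_int, e_add _ (p * _)]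
  have : e (p * (z + a * η / p)) * e (-(p * (z + a * η / p))) = 1 := by
    rw [← e_add, add_neg_cancel, e_zero]
  linear_combination e (a * z + a * (a - p) / (2 * p) * η + a / 2)
    * thetaPi p η (z + a * η / p) * this

theorem thetaInt_congr (hp : Odd p) {a b : ℤ} (h : (a : ZMod p) = b) (z : ℂ) :
    thetaInt p η a z = thetaInt p η b z := by
  obtain ⟨n, rfl⟩ : ∃ n, b = a + n * p := by
    obtain ⟨n, hn⟩ := (ZMod.intCast_eq_intCast_iff_dvd_sub a b p).mp h
    exact ⟨n, by linear_combination hn⟩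
  clear h
  induction n using Int.induction_on with
  | zero => simp
  | succ n ih => rw [ih, ← thetaInt_add_self η hp (a + n * p)]; congr 1; ring
  | pred n ih => rw [ih, ← thetaInt_add_self η hp (a + (-n - 1) * p)]; congr 1; ring

theorem thetaMod_intCast (hp : Odd p) (a : ℤ) (z : ℂ) :
    thetaMod p η (a : ZMod p) z = thetaInt p η a z :=
  thetaInt_congr η hp (by simp) z

theorem thetaMod_add_inv (hp : Odd p) (α : ZMod p) (z : ℂ) :
    thetaMod p η α (z + 1 / p) = ZMod.stdAddChar α * thetaMod p η α z := by
  obtain ⟨a, rfl⟩ := ZMod.intCast_surjective α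
  rw [thetaMod_intCast η hp, thetaMod_intCast η hp, ZMod.stdAddChar_coe, thetaInt, thetaInt,
    add_right_comm z, thetaPi_add_inv, ← mul_assoc]
  congr 1
  rw [e, e, ← Complex.exp_add]
  congr 1
  ring

theorem thetaMod_add_one (hp : Odd p) (α : ZMod p) (z : ℂ) :
    thetaMod p η α (z + 1) = thetaMod p η α z := by
  have hp0 := cast_ne_zero_of_neZero (p := p)
  have h : ∀ n : ℕ, thetaMod p η α (z + n / p) = ZMod.stdAddChar ((n : ZMod p) * α) * thetaMod p η α z := by
    intro n
    induction n with
    | zero => simp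
    | succ n ih =>
      rw [show z + ((n + 1 : ℕ) : ℂ) / p = z + n / p + 1 / p by push_cast; ring,
        thetaMod_add_inv η hp, ih, ← mul_assoc, ← AddChar.map_add_eq_mul]
      congr 2
      push_cast; ring
  simpa [div_self hp0] using h p

theorem thetaMod_add_period (hp : Odd p) (α : ZMod p) (z : ℂ) :
    thetaMod p η α (z + η) = -e (-(p * z)) * thetaMod p η α z := by
  have hp0 := cast_ne_zero_of_neZero (p := p)
  obtain ⟨a, rfl⟩ := ZMod.intCast_surjective α
  rw [thetaMod_intCast η hp, thetaMod_intCast η hp, thetaInt, thetaInt,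
    add_right_comm z, thetaPi_add η hp, show (a : ℂ) * (z + η) + a * (a - p) / (2 * p) * η + a / 2
      = (a * z + a * (a - p) / (2 * p) * η + a / 2) + a * η by ring, e_add _ (a * η),
    show -(p * (z + a * η / p)) = -(p * z) + -(a * η) by field_simp; ring, e_add (-(p * z)),
    e_neg (a * η)]
  have := e_ne_zero (a * η)
  field_simp

/-- The factor does not depend on `α`; the normalization by `e (a / 2)` is chosen for this. -/
theorem thetaMod_neg (hp : Odd p) (α : ZMod p) (z : ℂ) :
    thetaMod p η α (-z) = -e (-(p * z)) * thetaMod p η (-α) z := by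
  have hp0 := cast_ne_zero_of_neZero (p := p)
  obtain ⟨a, rfl⟩ := ZMod.intCast_surjective α
  rw [← Int.cast_neg, thetaMod_intCast η hp, thetaMod_intCast η hp, thetaInt, thetaInt,
    show -z + a * η / p = -(z + (-a : ℤ) * η / p) by push_cast; ring, thetaPi_neg η hp,
    ← mul_assoc, ← mul_assoc, mul_neg, neg_mul (e _), ← e_add, ← e_add]
  congr 2
  rw [← mul_one (e (_ + ((-a : ℤ) * z + _ + _))), ← e_int a, ← e_add]
  congr 1
  push_cast
  field_simp
  ring

/-- Translation by `c η / p` shifts the index, so questions about any index reduce to index `0`,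
whose zeros are known. -/
theorem thetaMod_add_intCast (hp : Odd p) (α : ZMod p) (c : ℤ) (z : ℂ) :
    thetaMod p η (α + c) z = shiftFactor p η c z * thetaMod p η α (z + c * η / p) := by
  have hp0 := cast_ne_zero_of_neZero (p := p)
  obtain ⟨a, rfl⟩ := ZMod.intCast_surjective α
  rw [← Int.cast_add, thetaMod_intCast η hp, thetaMod_intCast η hp, thetaInt, thetaInt, shiftFactor,
    ← mul_assoc, ← e_add]
  congr 2
  · push_cast; field_simp; ring
  · push_cast; field_simp; ring

/-- The two normalizations differ by `exp(2πi α (1 - p) / (2p))`, a character of `ZMod p` since `p`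
is odd. It cancels from the Sklyanin relations, whose numerator index is the sum of the denominator
indices. -/
theorem thetaN_eq (hp : Odd p) : ∃ h : ZMod p, ∀ (α : ZMod p) (z : ℂ),
    thetaN p η α z = ZMod.stdAddChar (h * α) * thetaMod p η α z := by
  have hp0 := cast_ne_zero_of_neZero (p := p)
  obtain ⟨k, hk⟩ := id hp
  refine ⟨-(k : ZMod p), fun α z => ?_⟩
  have hα : -(k : ZMod p) * α = ((-(k : ℤ) * (α.val : ℤ) : ℤ) : ZMod p) := by simp
  rw [hα, ZMod.stdAddChar_coe, thetaN, thetaMod, thetaInt, thetaPi, ← mul_assoc, e,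
    ← Complex.exp_add]
  congr 1
  · congr 1
    have : (k : ℂ) = (p - 1) / 2 := by rw [hk]; push_cast; ring
    push_cast
    rw [this]
    field_simp
    ring
  · refine Finset.prod_congr rfl fun s _ => ?_
    congr 1
    push_cast
    ring

end

/-! ### Cauchy matrices, and residues modulo `p` up to sign -/

/-- Nonsingularity of Cauchy matrices. -/
theorem eq_zero_of_cauchy_sum_eq_zero {ι K : Type*} [Fintype ι] [Field K] {x y ψ : ι → K}
    (hx : Function.Injective x) (hy : Function.Injective y) (hxy : ∀ k m, x k - y m ≠ 0)
    (h : ∀ k, ∑ m, ψ m / (x k - y m) = 0) : ψ = 0 := by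
  classical
  -- The numerator of `∑ ψ m / (X - y m)`: its degree is less than the number of its zeros `x k`,
  -- and its value at `y m` is a nonzero multiple of `ψ m`.
  let P : Polynomial K := ∑ m, Polynomial.C (ψ m) *
    ∏ m' ∈ Finset.univ.erase m, (Polynomial.X - Polynomial.C (y m'))
  have hdeg : P.degree < (Finset.univ : Finset ι).card := by
    refine (Polynomial.degree_sum_le _ _).trans_lt ?_
    rw [Finset.sup_lt_iff (WithBot.bot_lt_coe _)]
    intro m _
    rw [← Polynomial.smul_eq_C_mul]
    refine (Polynomial.degree_smul_le _ _).trans_lt ?_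
    rw [Polynomial.degree_prod]
    simp only [Polynomial.degree_X_sub_C, Finset.sum_const, nsmul_eq_mul, mul_one]
    exact_mod_cast Finset.card_erase_lt_of_mem (Finset.mem_univ m)
  have heval : ∀ k, P.eval (x k) = 0 := fun k => by
    have : P.eval (x k) = (∏ m, (x k - y m)) * ∑ m, ψ m / (x k - y m) := by
      rw [Finset.mul_sum]
      simp only [P, Polynomial.eval_finsetSum, Polynomial.eval_mul, Polynomial.eval_C,
        Polynomial.eval_prod, Polynomial.eval_sub, Polynomial.eval_X]
      refine Finset.sum_congr rfl fun m _ => ?_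
      rw [← Finset.mul_prod_erase Finset.univ _ (Finset.mem_univ m)]
      field_simp [hxy k m]
    rw [this, h, mul_zero]
  have hP : P = 0 := Polynomial.eq_zero_of_degree_lt_of_eval_index_eq_zero (v := x) Finset.univ
    hx.injOn hdeg fun k _ => heval k
  ext m
  have hm : P.eval (y m) = ψ m * ∏ m' ∈ Finset.univ.erase m, (y m - y m') := by
    simp only [P, Polynomial.eval_finsetSum, Polynomial.eval_mul, Polynomial.eval_C,
        Polynomial.eval_prod, Polynomial.eval_sub, Polynomial.eval_X]
    refine Finset.sum_eq_single m (fun b _ hb => ?_) (by simp)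
    rw [Finset.prod_eq_zero (i := m) (by simp [hb.symm]) (sub_self _), mul_zero]
  rw [hP, Polynomial.eval_zero] at hm
  refine (mul_eq_zero.mp hm.symm).resolve_right (Finset.prod_ne_zero_iff.mpr fun m' hm' => ?_)
  exact sub_ne_zero.mpr fun h => (Finset.mem_erase.mp hm').1 (hy h).symm

theorem exists_natCast_eq_or_neg {p : ℕ} [NeZero p] (hp : Odd p) {α : ZMod p} (hα : α ≠ 0) :
    ∃ i ∈ Finset.Icc 1 ((p - 1) / 2), α = i ∨ α = -i := by
  obtain ⟨k, hk⟩ := hp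
  have h1 := ZMod.val_lt α
  have h2 : α.val ≠ 0 := by rwa [Ne, ZMod.val_eq_zero]
  by_cases h : α.val ≤ k
  · exact ⟨α.val, by simp; omega, Or.inl (by simp)⟩
  · refine ⟨p - α.val, by simp; omega, Or.inr ?_⟩
    rw [Nat.cast_sub h1.le]; simp

theorem natCast_ne_zero_of_mem_Icc {p : ℕ} {i : ℕ} (hi : i ∈ Finset.Icc 1 ((p - 1) / 2)) :
    (i : ZMod p) ≠ 0 := by
  rw [Finset.mem_Icc] at hi
  rw [Ne, ZMod.natCast_eq_zero_iff]
  exact fun h => by have := Nat.le_of_dvd (by omega) h; omega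

theorem natCast_add_ne_zero_of_mem_Icc {p : ℕ} {i j : ℕ} (hi : i ∈ Finset.Icc 1 ((p - 1) / 2))
    (hj : j ∈ Finset.Icc 1 ((p - 1) / 2)) : (i + j : ZMod p) ≠ 0 := by
  rw [Finset.mem_Icc] at hi hj
  rw [← Nat.cast_add, Ne, ZMod.natCast_eq_zero_iff]
  exact fun h => by have := Nat.le_of_dvd (by omega) h; omega

theorem natCast_injOn_Icc {p : ℕ} {i j : ℕ} (hi : i ∈ Finset.Icc 1 ((p - 1) / 2))
    (hj : j ∈ Finset.Icc 1 ((p - 1) / 2)) (h : (i : ZMod p) = j) : i = j := by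
  rw [Finset.mem_Icc] at hi hj
  rw [ZMod.natCast_eq_natCast_iff', Nat.mod_eq_of_lt (by omega), Nat.mod_eq_of_lt (by omega)] at h
  exact h

theorem sum_zmod_of_even {p : ℕ} [NeZero p] (hp : Odd p) {M : Type*} [AddCommMonoid M]
    {F : ZMod p → M} (hF : ∀ α, F (-α) = F α) :
    ∑ α, F α = F 0 + 2 • ∑ i : Finset.Icc 1 ((p - 1) / 2), F ((i : ℕ) : ZMod p) := by
  classical
  have hsplit : (Finset.univ : Finset (ZMod p)) = insert 0
      ((Finset.Icc 1 ((p - 1) / 2)).image (fun i : ℕ => (i : ZMod p)) ∪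
        (Finset.Icc 1 ((p - 1) / 2)).image (fun i : ℕ => -(i : ZMod p))) := by
    ext α
    simp only [Finset.mem_univ, Finset.mem_insert, Finset.mem_union, Finset.mem_image, true_iff]
    by_cases hα : α = 0
    · exact Or.inl hα
    · obtain ⟨i, hi, h | h⟩ := exists_natCast_eq_or_neg hp hα
      · exact Or.inr (Or.inl ⟨i, hi, h.symm⟩)
      · exact Or.inr (Or.inr ⟨i, hi, h.symm⟩)
  rw [hsplit, Finset.sum_insert, Finset.sum_union, Finset.sum_image, Finset.sum_image]
  · simp only [hF]
    rw [← two_nsmul, Finset.sum_coe_sort (Finset.Icc 1 ((p - 1) / 2)) (fun i => F (i : ZMod p))]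
  · exact fun i hi j hj h => natCast_injOn_Icc hi hj (neg_injective h)
  · exact fun i hi j hj h => natCast_injOn_Icc hi hj h
  · rw [Finset.disjoint_left]
    simp only [Finset.mem_image, not_exists, not_and]
    rintro _ ⟨i, hi, rfl⟩ j hj h
    exact natCast_add_ne_zero_of_mem_Icc hi hj (by rw [← h]; simp)
  · simp only [Finset.mem_union, Finset.mem_image, not_or, not_exists, not_and, neg_eq_zero]
    exact ⟨fun i hi => natCast_ne_zero_of_mem_Icc hi, fun i hi => natCast_ne_zero_of_mem_Icc hi⟩

/-! ### Zeros of `θ_0` and functions of degree two -/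

section

variable {p : ℕ} [Fact p.Prime] (η : UpperHalfPlane)

theorem thetaMod_zero_eq_zero_iff (z : ℂ) :
    thetaMod p η 0 z = 0 ↔ ∃ m n : ℤ, z = m / p + n * η := by
  rw [thetaMod_zero, thetaPi_eq_zero_iff]

theorem thetaMod_zero_zero : thetaMod p η 0 0 = 0 :=
  (thetaMod_zero_eq_zero_iff η 0).mpr ⟨0, 0, by simp⟩

theorem thetaMod_zero_neg_eq_zero_iff (z : ℂ) :
    thetaMod p η 0 (-z) = 0 ↔ thetaMod p η 0 z = 0 := by
  rw [thetaMod_zero_eq_zero_iff, thetaMod_zero_eq_zero_iff]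
  constructor
  · rintro ⟨m, n, h⟩
    exact ⟨-m, -n, by push_cast; linear_combination -h⟩
  · rintro ⟨m, n, h⟩
    exact ⟨-m, -n, by push_cast; linear_combination -h⟩

theorem int_linear_eq {m n m' n' : ℤ} (h : (m + n * η : ℂ) = m' + n' * η) : m = m' ∧ n = n' := by
  have him := congrArg Complex.im h
  have hn : (n : ℝ) = n' := by simpa [η.im_ne_zero] using him
  have hn' : n = n' := by exact_mod_cast hn
  subst hn'
  exact ⟨by exact_mod_cast add_right_cancel h, rfl⟩

/-- `c η / p` is a zero of the theta function of index zero only for `c` divisible by `p`. -/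
theorem thetaMod_zero_div_ne_zero {c : ℤ} (hc : (c : ZMod p) ≠ 0) :
    thetaMod p η 0 (c * η / p) ≠ 0 := by
  have hp0 := cast_ne_zero_of_neZero (p := p)
  rw [Ne, thetaMod_zero_eq_zero_iff]
  rintro ⟨m, n, h⟩
  have h2 : ((0 : ℤ) + c * η : ℂ) = m + (p * n : ℤ) * η := by
    field_simp at h
    push_cast
    linear_combination h
  refine hc ?_
  rw [(int_linear_eq η h2).2]
  simp

theorem countable_zeros : {z | thetaMod p η 0 z = 0}.Countable := by
  refine (Set.countable_range fun q : ℤ × ℤ => (q.1 / p + q.2 * η : ℂ)).mono ?_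
  intro z hz
  obtain ⟨m, n, h⟩ := (thetaMod_zero_eq_zero_iff η z).mp hz
  exact ⟨(m, n), h.symm⟩

/-- The zeros are countable, so two translates of them cannot cover the plane. -/
theorem exists_translates_ne_zero (u v : ℂ) :
    ∃ z, thetaMod p η 0 (z + u) ≠ 0 ∧ thetaMod p η 0 (z + v) ≠ 0 := by
  by_contra! h
  have h1 : ∀ u : ℂ, {z | thetaMod p η 0 (z + u) = 0}.Countable := fun u =>
    (countable_zeros η).preimage (f := fun z => z + u) (add_left_injective u)
  refine not_countable_complex (((h1 u).union (h1 v)).mono fun z _ => ?_)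
  by_cases hz : thetaMod p η 0 (z + u) = 0
  · exact Or.inl hz
  · exact Or.inr (h z hz)

/-- The point is that one factor `M` serves all indices, so ratios of the `θ_α` descend to the
curve. -/
theorem thetaMod_add_lattice (hp : Odd p) (m n : ℤ) (z : ℂ) :
    ∃ M : ℂ, M ≠ 0 ∧ ∀ α : ZMod p, thetaMod p η α (z + (m + n * η)) = M * thetaMod p η α z := by
  have h1 : ∀ (α : ZMod p) (m : ℤ) (z : ℂ), thetaMod p η α (z + m) = thetaMod p η α z :=
    fun α m z => by
      simpa using (Function.Periodic.int_mul (thetaMod_add_one η hp α) m) z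
  have h2 : ∀ α : ZMod p, thetaMod p η α (z + (m + n * η)) = thetaMod p η α (z + n * η) :=
    fun α => by rw [← h1 α m (z + n * η)]; congr 1; ring
  simp only [h2]
  clear h2
  induction n using Int.induction_on with
  | zero => exact ⟨1, one_ne_zero, by simp⟩
  | succ n ih =>
    obtain ⟨M, hM, h⟩ := ih
    refine ⟨-e (-(p * (z + (n : ℤ) * η))) * M, by simp [e_ne_zero, hM], fun α => ?_⟩
    rw [mul_assoc, ← h, ← thetaMod_add_period η hp]
    congr 1; push_cast; ring
  | pred n ih =>
    obtain ⟨M, hM, h⟩ := ih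
    have hne : -e (-(p * (z + (-n - 1 : ℤ) * η))) ≠ 0 := by simp [e_ne_zero]
    refine ⟨(-e (-(p * (z + (-n - 1 : ℤ) * η))))⁻¹ * M, by simp [e_ne_zero, hM], fun α => ?_⟩
    rw [mul_assoc, ← h, eq_inv_mul_iff_mul_eq₀ hne, ← thetaMod_add_period η hp]
    congr 1; push_cast; ring

theorem shift_mul_thetaMod (hp : Odd p) (α : ZMod p) (c : ℤ) (z : ℂ) :
    thetaMod p η α (z + c * η / p) = (shiftFactor p η c z)⁻¹ * thetaMod p η (α + c) z := by
  rw [thetaMod_add_intCast η hp, inv_mul_cancel_left₀ (shiftFactor_ne_zero η c z)]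

/-- Opposite indices make the characters under translation by `1/p` cancel, and the automorphy
factor depends only on `u + v`. Products with a common sum of shifts therefore lie in one space of
dimension at most two. -/
theorem thetaMod_mul_mem (hp : Odd p) {u v σ : ℂ} (h : u + v = σ) (α : ZMod p) :
    (fun z => thetaMod p η α (z + u) * thetaMod p η (-α) (z + v)) ∈
      thetaSpace p η 2 (e (-(p * σ))) := by
  refine ⟨?_, fun z => ?_, fun z => ?_⟩
  · exact ((differentiable_thetaMod η α).comp (by fun_prop)).mul
      ((differentiable_thetaMod η (-α)).comp (by fun_prop))
  · simp only [add_right_comm z (1 / p : ℂ), thetaMod_add_inv η hp]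
    rw [mul_mul_mul_comm, ← AddChar.map_add_eq_mul]
    simp
  · simp only [add_right_comm z (η : ℂ), thetaMod_add_period η hp]
    have : e (-(p * σ)) * e (-(2 : ℕ) * (p * z)) = e (-(p * (z + u))) * e (-(p * (z + v))) := by
      rw [← e_add, ← e_add, ← h]; congr 1; push_cast; ring
    rw [this]; ring

theorem thetaMod_zero_mul_mem (hp : Odd p) {u v σ : ℂ} (h : u + v = σ) :
    (fun z => thetaMod p η 0 (z + u) * thetaMod p η 0 (z + v)) ∈
      thetaSpace p η 2 (e (-(p * σ))) := by
  simpa using thetaMod_mul_mem η hp h 0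

/-- A function of degree two with a zero at `a` is determined up to a scalar. -/
theorem exists_eq_mul_of_zero (hp : Odd p) {σ a : ℂ} {H : ℂ → ℂ} (hH : H ∈ thetaSpace p η 2 (e (-(p * σ))))
    (ha : H a = 0) :
    ∃ c : ℂ, ∀ z, H z = c * (thetaMod p η 0 (z - a) * thetaMod p η 0 (z + (σ + a))) := by
  -- A third member of the space, with parameter `w`, is chosen not to vanish at `a`. In a linear
  -- relation among the three functions, evaluation at `a` kills its coefficient; the point `x` then
  -- shows that the coefficient of `H` is nonzero.
  obtain ⟨w, hw1, hw2⟩ := exists_translates_ne_zero (p := p) η a (-(σ + a))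
  have hw3 : thetaMod p η 0 (a + (σ - w)) ≠ 0 := by
    rwa [Ne, ← thetaMod_zero_neg_eq_zero_iff, show -(a + (σ - w)) = w + -(σ + a) by ring]
  obtain ⟨x, hx1, hx2⟩ := exists_translates_ne_zero (p := p) η (-a) (σ + a)
  have := finite_thetaSpace (NeZero.ne p) (η : ℂ) two_pos (e_ne_zero (-(p * σ)))
  have hr := finrank_thetaSpace_le (NeZero.ne p) (η : ℂ) two_pos (e_ne_zero (-(p * σ)))
  let v : Fin 3 → thetaSpace p η 2 (e (-(p * σ))) := ![⟨H, hH⟩,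
    ⟨_, thetaMod_zero_mul_mem η hp (show -a + (σ + a) = σ by ring)⟩,
    ⟨_, thetaMod_zero_mul_mem η hp (show w + (σ - w) = σ by ring)⟩]
  have hdep : ¬ LinearIndependent ℂ v := fun hli => by
    have := hli.fintype_card_le_finrank
    simp at this
    omega
  obtain ⟨g, hg, i, hi⟩ := Fintype.not_linearIndependent_iff.mp hdep
  have hz : ∀ z, g 0 * H z + g 1 * (thetaMod p η 0 (z + -a) * thetaMod p η 0 (z + (σ + a)))
      + g 2 * (thetaMod p η 0 (z + w) * thetaMod p η 0 (z + (σ - w))) = 0 := fun z => by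
    have := congrFun (congrArg Subtype.val hg) z
    simpa [Fin.sum_univ_three, v] using this
  have h2 : g 2 = 0 := by
    have := hz a
    rw [ha, add_neg_cancel, thetaMod_zero_zero] at this
    simpa [hw3, add_comm a w, hw1] using this
  have h0 : g 0 ≠ 0 := by
    intro h0
    have := hz x
    simp only [h0, h2, zero_mul, zero_add, add_zero, mul_eq_zero, hx1, hx2, or_false] at this
    fin_cases i
    · exact hi h0
    · exact hi this
    · exact hi h2
  refine ⟨-(g 1 / g 0), fun z => ?_⟩
  have := hz z
  rw [h2] at this
  rw [sub_eq_add_neg z a]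
  field_simp
  linear_combination this

end

/-! ### Half periods and the coefficients `φ` -/

/-- A complex number representing a point of order two. -/
structure IsHalfPeriod (η : UpperHalfPlane) (τ : ℂ) : Prop where
  notMem : τ ∉ lattice η
  two_mul_mem : 2 * τ ∈ lattice η

/-- For odd `p` one has `p τ ≡ τ` modulo the lattice. This keeps `τ` away from the zeros of all the
`θ_α`. -/
theorem IsHalfPeriod.mul_notMem {p : ℕ} {η : UpperHalfPlane} {τ : ℂ}
    (hτ : IsHalfPeriod η τ) (hp : Odd p) : (p : ℂ) * τ ∉ lattice η := by
  obtain ⟨k, hk⟩ := hp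
  intro h
  have h2 : (k : ℂ) * (2 * τ) ∈ lattice η := by
    simpa using (lattice η).nsmul_mem hτ.two_mul_mem k
  have h3 := (lattice η).sub_mem h h2
  rw [hk] at h3
  refine hτ.notMem ?_
  convert h3 using 1
  push_cast; ring

section

variable {p : ℕ} [Fact p.Prime] {η : UpperHalfPlane} {τ : ℂ}

theorem IsHalfPeriod.thetaMod_ne_zero (hτ : IsHalfPeriod η τ) (hp : Odd p) (α : ZMod p) :
    thetaMod p η α τ ≠ 0 := by
  have hp0 := cast_ne_zero_of_neZero (p := p)
  obtain ⟨a, rfl⟩ := ZMod.intCast_surjective α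
  rw [← zero_add (a : ZMod p), thetaMod_add_intCast η hp]
  refine mul_ne_zero (shiftFactor_ne_zero η a τ) ?_
  rw [Ne, thetaMod_zero_eq_zero_iff]
  rintro ⟨m, n, h⟩
  refine hτ.mul_notMem hp ((mem_lattice_iff η _).mpr ⟨m, p * n - a, ?_⟩)
  field_simp at h
  push_cast
  linear_combination h

theorem IsHalfPeriod.thetaMod_add_two_mul (hτ : IsHalfPeriod η τ) (hp : Odd p) (z : ℂ) :
    ∃ M : ℂ, M ≠ 0 ∧ ∀ α : ZMod p, thetaMod p η α (z + 2 * τ) = M * thetaMod p η α z := by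
  obtain ⟨m, n, h⟩ := (mem_lattice_iff η _).mp hτ.two_mul_mem
  rw [h]
  exact thetaMod_add_lattice η hp m n z

theorem thetaMod_neg_zero (hp : Odd p) (α : ZMod p) : thetaMod p η (-α) 0 = -thetaMod p η α 0 := by
  have := thetaMod_neg η hp (-α) 0
  simpa [e_zero] using this

theorem IsHalfPeriod.exists_thetaMod_neg (hτ : IsHalfPeriod η τ) (hp : Odd p) :
    ∃ M : ℂ, M ≠ 0 ∧ ∀ α : ZMod p, thetaMod p η α (-τ) = M * thetaMod p η α τ := by
  obtain ⟨M, hM, h⟩ := hτ.thetaMod_add_two_mul hp (-τ)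
  refine ⟨M⁻¹, inv_ne_zero hM, fun α => ?_⟩
  rw [eq_inv_mul_iff_mul_eq₀ hM, ← h]
  congr 1; ring

/-- Compute `θ_α(-τ)` twice, from `2τ` being a period and from the parity rule. Both factors are
independent of `α`, and index `0`, where `θ_0(τ) ≠ 0`, shows that they agree. -/
theorem IsHalfPeriod.thetaMod_neg_index (hτ : IsHalfPeriod η τ) (hp : Odd p) (α : ZMod p) :
    thetaMod p η (-α) τ = thetaMod p η α τ := by
  obtain ⟨M, hM, h⟩ := hτ.exists_thetaMod_neg (p := p) hp
  have h2 : ∀ α : ZMod p, M * thetaMod p η α τ = -e (-(p * τ)) * thetaMod p η (-α) τ :=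
    fun α => by rw [← h, thetaMod_neg η hp]
  have h0 := h2 0
  rw [neg_zero] at h0
  have h3 := mul_right_cancel₀ (hτ.thetaMod_ne_zero hp 0) h0
  have h4 := h2 α
  rw [h3] at h4
  exact (mul_left_cancel₀ (by simp [e_ne_zero]) h4).symm

/-- The symmetrization of `θ_α(z) θ_{-α}(z + τ)` is a multiple of `θ_0(z) θ_0(z + τ)`. -/
theorem IsHalfPeriod.exists_symmetrization (hτ : IsHalfPeriod η τ) (hp : Odd p) (α : ZMod p) :
    ∃ c : ℂ, ∀ z, thetaMod p η α z * thetaMod p η (-α) (z + τ)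
      + thetaMod p η (-α) z * thetaMod p η α (z + τ)
      = 2 * c * (thetaMod p η 0 z * thetaMod p η 0 (z + τ)) := by
  have h1 := thetaMod_mul_mem η hp (zero_add τ) α
  have h2 := thetaMod_mul_mem η hp (zero_add τ) (-α)
  -- At `z = 0` the two terms cancel: the index is odd at `0` and even at `τ`.
  obtain ⟨c, hc⟩ := exists_eq_mul_of_zero (a := 0) η hp (Submodule.add_mem _ h1 h2) (by
    simp only [Pi.add_apply, neg_neg, zero_add, thetaMod_neg_zero hp α,
      hτ.thetaMod_neg_index hp α]
    ring)
  refine ⟨c / 2, fun z => ?_⟩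
  have := hc z
  simp only [Pi.add_apply, neg_neg, add_zero, sub_zero] at this
  rw [this]; ring

theorem two_ne_zero_zmod (hp : Odd p) : (2 : ZMod p) ≠ 0 := by
  intro h
  have := (ZMod.natCast_eq_zero_iff 2 p).mp (by exact_mod_cast h)
  have := (Nat.prime_dvd_prime_iff_eq Fact.out Nat.prime_two).mp this
  subst this
  exact absurd hp (by decide)

/-- The coefficients of the quadratic forms attached to a half period. -/
theorem IsHalfPeriod.exists_coefficients (hτ : IsHalfPeriod η τ) (hp : Odd p) :
    ∃ φ : ZMod p → ℂ, φ 0 = 1 ∧ (∀ d, φ (-d) = φ d) ∧ (∀ d, φ d ≠ 0) ∧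
      ∀ d z, thetaMod p η d z * thetaMod p η (-d) (z + τ)
        + thetaMod p η (-d) z * thetaMod p η d (z + τ)
        = 2 * φ d * (thetaMod p η 0 z * thetaMod p η 0 (z + τ)) := by
  have hp0 := cast_ne_zero_of_neZero (p := p)
  choose φ hφ using hτ.exists_symmetrization (p := p) hp
  obtain ⟨w, hw1, hw2⟩ := exists_translates_ne_zero (p := p) η 0 τ
  rw [add_zero] at hw1
  have hw := mul_ne_zero hw1 hw2
  have h0 : φ 0 = 1 := by
    have := hφ 0 w
    rw [neg_zero, ← two_mul, mul_assoc] at this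
    exact (mul_right_cancel₀ hw (by rw [one_mul]; exact mul_left_cancel₀ two_ne_zero this)).symm
  refine ⟨φ, h0, fun d => ?_, fun d => ?_, hφ⟩
  · have h1 := hφ d w
    have h2 := hφ (-d) w
    rw [neg_neg, add_comm, h1] at h2
    have := mul_right_cancel₀ hw h2
    linear_combination -this / 2
  · by_cases hd : d = 0
    · rw [hd, h0]; exact one_ne_zero
    obtain ⟨a, rfl⟩ := ZMod.intCast_surjective d
    intro h
    -- At `-a η / p` the function `θ_a` vanishes, while the other term is a nonzero multiple of
    -- `θ_{-2a}(0) θ_0(τ)`, and `2a ≠ 0` in `ZMod p`.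
    have h1 := hφ a (0 + (-a : ℤ) * η / p)
    rw [h, add_right_comm _ _ τ] at h1
    simp only [shift_mul_thetaMod η hp] at h1
    simp only [Int.cast_neg, add_neg_cancel, thetaMod_zero_zero, mul_zero, zero_mul, zero_add,
      mul_eq_zero, inv_eq_zero, shiftFactor_ne_zero, hτ.thetaMod_ne_zero hp, or_false,
      false_or] at h1
    have h2 : ((-(2 * a) : ℤ) : ZMod p) ≠ 0 := by
      push_cast
      exact neg_ne_zero.mpr (mul_ne_zero (two_ne_zero_zmod hp) hd)
    rw [show -(a : ZMod p) + -a = 0 + ((-(2 * a) : ℤ) : ZMod p) by push_cast; ring,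
      thetaMod_add_intCast η hp, zero_add] at h1
    exact mul_ne_zero (shiftFactor_ne_zero η _ _) (thetaMod_zero_div_ne_zero η h2) h1

theorem IsHalfPeriod.sum_odd (hτ : IsHalfPeriod η τ) (hp : Odd p) :
    ∑ m : ZMod p, thetaMod p η m 0 / thetaMod p η m τ = 0 := by
  have h := Equiv.sum_comp (Equiv.neg (ZMod p)) (fun m => thetaMod p η m 0 / thetaMod p η m τ)
  simp only [Equiv.neg_apply, thetaMod_neg_zero hp, hτ.thetaMod_neg_index hp, neg_div,
    Finset.sum_neg_distrib] at h
  linear_combination -h / 2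

/-- The sum is a function of degree two vanishing at both points `τ ± c η / p`, where `c` lifts `k`.
A nonzero such function with a zero at one of them cannot vanish at the other, because `2c` is
nonzero modulo `p`. -/
theorem IsHalfPeriod.sum_thetaMod_mul_div_eq_zero (hτ : IsHalfPeriod η τ) (hp : Odd p) {k : ZMod p}
    (hk : k ≠ 0) (z : ℂ) :
    ∑ m, thetaMod p η m z * thetaMod p η (-m) (z + τ)
      / (thetaMod p η (k + m) τ * thetaMod p η (k - m) τ) = 0 := by
  have hp0 := cast_ne_zero_of_neZero (p := p)
  have ht := hτ.thetaMod_ne_zero (p := p) hp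
  obtain ⟨c, rfl⟩ := ZMod.intCast_surjective k
  let H : ℂ → ℂ := ∑ m : ZMod p, (thetaMod p η (c + m) τ * thetaMod p η (c - m) τ)⁻¹ •
    fun z => thetaMod p η m (z + 0) * thetaMod p η (-m) (z + τ)
  have hH : H ∈ thetaSpace p η 2 (e (-(p * τ))) :=
    Submodule.sum_mem _ fun m _ => Submodule.smul_mem _ _ (thetaMod_mul_mem η hp (zero_add τ) m)
  have hHz : ∀ z, H z = ∑ m, thetaMod p η m z * thetaMod p η (-m) (z + τ)
      / (thetaMod p η (c + m) τ * thetaMod p η (c - m) τ) := fun z => by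
    simp only [H, Finset.sum_apply, Pi.smul_apply, add_zero, smul_eq_mul]
    exact Finset.sum_congr rfl fun m _ => by rw [div_eq_inv_mul]
  -- At these points one denominator factor cancels, and the sum becomes a multiple of `∑ θ_m(0) /
  -- θ_m(τ)`, which is zero because its terms are odd in `m`.
  have hzero : ∀ c' : ℤ, (c' : ZMod p) = c ∨ (c' : ZMod p) = -c → H (τ + c' * η / p) = 0 := by
    intro c' hc'
    obtain ⟨M, hM, hM2⟩ := hτ.thetaMod_add_two_mul hp 0
    have h1 : ∀ m : ZMod p, thetaMod p η (-m) (τ + c' * η / p + τ)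
        = (shiftFactor p η c' (0 + 2 * τ))⁻¹ * (M * thetaMod p η (-m + c') 0) := fun m => by
      rw [show τ + c' * η / p + τ = (0 + 2 * τ) + c' * η / p by ring, shift_mul_thetaMod η hp, hM2]
    rw [hHz]
    simp only [h1, shift_mul_thetaMod η hp]
    generalize (shiftFactor p η c' τ)⁻¹ = A
    generalize (shiftFactor p η c' (0 + 2 * τ))⁻¹ = B
    refine Eq.trans (b := A * B * M * ∑ m : ZMod p, thetaMod p η m 0 / thetaMod p η m τ) ?_
      (by rw [hτ.sum_odd hp, mul_zero])
    rw [Finset.mul_sum]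
    rcases hc' with hc' | hc'
    · rw [← Equiv.sum_comp (Equiv.subLeft (c : ZMod p))
        (fun m => A * B * M * (thetaMod p η m 0 / thetaMod p η m τ))]
      refine Finset.sum_congr rfl fun m _ => ?_
      rw [hc', Equiv.subLeft_apply, neg_add_eq_sub, add_comm m]
      have := ht (c + m)
      have := ht (c - m)
      field_simp
    · rw [← Equiv.sum_comp ((Equiv.neg _).trans (Equiv.subRight (c : ZMod p)))
        (fun m => A * B * M * (thetaMod p η m 0 / thetaMod p η m τ))]
      refine Finset.sum_congr rfl fun m _ => ?_
      have e1 : thetaMod p η (-m - c) τ = thetaMod p η (c + m) τ := by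
        rw [← hτ.thetaMod_neg_index hp]; congr 1; ring
      have e2 : thetaMod p η (m + -c) τ = thetaMod p η (c - m) τ := by
        rw [← hτ.thetaMod_neg_index hp]; congr 1; ring
      rw [hc', Equiv.trans_apply, Equiv.neg_apply, Equiv.subRight_apply, ← sub_eq_add_neg (-m), e1,
        e2]
      have := ht (c + m)
      have := ht (c - m)
      field_simp
  obtain ⟨d, hd⟩ := exists_eq_mul_of_zero η hp hH (hzero c (Or.inl rfl))
  -- Evaluating the product form at the second zero gives `d` times the nonzero values at `-2c η /
  -- p` and at `τ + 2τ`.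
  have h2 := hd (τ + (-c : ℤ) * η / p)
  rw [hzero (-c) (Or.inr (by simp)),
    show τ + (-c : ℤ) * η / p - (τ + c * η / p) = (-(2 * c) : ℤ) * η / p by push_cast; ring,
    show τ + (-c : ℤ) * η / p + (τ + (τ + c * η / p)) = τ + 2 * τ by push_cast; ring] at h2
  obtain ⟨M, hM, hM2⟩ := hτ.thetaMod_add_two_mul hp τ
  rw [hM2] at h2
  have hc2 : ((-(2 * c) : ℤ) : ZMod p) ≠ 0 := by
    push_cast
    exact neg_ne_zero.mpr (mul_ne_zero (two_ne_zero_zmod hp) hk)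
  have hd0 : d = 0 := by
    have := thetaMod_zero_div_ne_zero η hc2
    exact (mul_eq_zero.mp h2.symm).resolve_right (mul_ne_zero this (mul_ne_zero hM (ht 0)))
  rw [← hHz, hd, hd0, zero_mul]

/-- The coefficients of the Sklyanin relations are orthogonal to the coefficients `φ`. -/
theorem IsHalfPeriod.sum_coefficients_eq_zero (hτ : IsHalfPeriod η τ) (hp : Odd p) {φ : ZMod p → ℂ}
    (hφ : ∀ d z, thetaMod p η d z * thetaMod p η (-d) (z + τ)
        + thetaMod p η (-d) z * thetaMod p η d (z + τ)
        = 2 * φ d * (thetaMod p η 0 z * thetaMod p η 0 (z + τ))) {k : ZMod p} (hk : k ≠ 0) :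
    ∑ m, φ m / (thetaMod p η (k + m) τ * thetaMod p η (k - m) τ) = 0 := by
  obtain ⟨w, hw1, hw2⟩ := exists_translates_ne_zero (p := p) η 0 τ
  rw [add_zero] at hw1
  have h1 := hτ.sum_thetaMod_mul_div_eq_zero hp hk w
  have h2 := h1
  -- The denominator is even in `m`, so adding the sum reindexed by `-m` makes the symmetrization,
  -- hence `φ m`, appear in each term.
  rw [← Equiv.sum_comp (Equiv.neg (ZMod p))] at h2
  have h3 := congrArg₂ (· + ·) h1 h2
  simp only [← Finset.sum_add_distrib, add_zero, Equiv.neg_apply, neg_neg, sub_neg_eq_add,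
    ← sub_eq_add_neg] at h3
  have h4 : ∀ m, thetaMod p η m w * thetaMod p η (-m) (w + τ)
      / (thetaMod p η (k + m) τ * thetaMod p η (k - m) τ)
      + thetaMod p η (-m) w * thetaMod p η m (w + τ)
      / (thetaMod p η (k - m) τ * thetaMod p η (k + m) τ)
      = 2 * (thetaMod p η 0 w * thetaMod p η 0 (w + τ)) *
        (φ m / (thetaMod p η (k + m) τ * thetaMod p η (k - m) τ)) := fun m => by
    rw [mul_comm (thetaMod p η (k - m) τ), ← add_div, hφ]; ring
  rw [Finset.sum_congr rfl fun m _ => h4 m, ← Finset.mul_sum] at h3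
  exact (mul_eq_zero.mp h3).resolve_left (mul_ne_zero two_ne_zero (mul_ne_zero hw1 hw2))

end

/-- Nonsingularity of Cauchy matrices in homogeneous form. -/
theorem eq_zero_of_rank_two_cauchy {ι K : Type*} [Fintype ι] [Field K] {D₁ D₂ R T ψ : ι → K}
    {E : ι → ι → K} (hE : ∀ k m, E k m = R m * D₁ k + T m * D₂ k) (hD : ∀ k, D₂ k ≠ 0)
    (hR : ∀ m, R m ≠ 0) (hE0 : ∀ k m, E k m ≠ 0)
    (hrow : ∀ i j, i ≠ j → D₁ i * D₂ j ≠ D₁ j * D₂ i)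
    (hcol : ∀ i j, i ≠ j → T i * R j ≠ T j * R i) (h : ∀ k, ∑ m, ψ m / E k m = 0) : ψ = 0 := by
  have hfac : ∀ k m, E k m = R m * D₂ k * (D₁ k / D₂ k - -(T m / R m)) := fun k m => by
    rw [hE]
    have := hR m
    have := hD k
    field_simp
    ring
  have hcauchy : (fun m => ψ m / R m) = 0 := by
    refine eq_zero_of_cauchy_sum_eq_zero (x := fun k => D₁ k / D₂ k) (y := fun m => -(T m / R m))
      (fun i j hij => ?_) (fun i j hij => ?_) (fun k m h0 => hE0 k m ?_) (fun k => ?_)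
    · by_contra hne
      exact hrow i j hne ((div_eq_div_iff (hD i) (hD j)).mp hij)
    · by_contra hne
      exact hcol i j hne ((div_eq_div_iff (hR i) (hR j)).mp (neg_injective hij))
    · rw [hfac, h0, mul_zero]
    · refine (mul_eq_zero.mp (Eq.trans ?_ (h k))).resolve_left (inv_ne_zero (hD k))
      rw [Finset.mul_sum]
      refine Finset.sum_congr rfl fun m _ => ?_
      rw [hfac k m]
      simp only [div_eq_mul_inv, mul_inv, mul_assoc, mul_left_comm]
  ext m
  exact (div_eq_zero_iff.mp (congrFun hcauchy m)).resolve_right (hR m)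

/-! ### Maximal rank of the relations of a fixed weight -/

section

variable {p : ℕ} [Fact p.Prime] {η : UpperHalfPlane} {τ : ℂ}

/-- The product of two translates of `θ_0`, as an even function of degree two about `-τ`. -/
def thetaPair (p : ℕ) (η : UpperHalfPlane) (τ v u : ℂ) : ℂ :=
  thetaMod p η 0 (u + (τ + v)) * thetaMod p η 0 (u + (τ - v))

/-- Expansion of `thetaPair` in two fixed functions. -/
theorem exists_thetaPair_eq (hp : Odd p) {w : ℂ} (hw : thetaMod p η 0 w ≠ 0) (v : ℂ) :
    ∃ R S : ℂ, ∀ u, thetaPair p η τ v u = R * thetaPair p η τ 0 u + S * thetaPair p η τ w u := by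
  have hmem : ∀ v, thetaPair p η τ v ∈ thetaSpace p η 2 (e (-(p * (2 * τ)))) := fun v =>
    thetaMod_zero_mul_mem η hp (by ring)
  have hw0 : thetaPair p η τ w (-τ) ≠ 0 := by
    rw [thetaPair, neg_add_cancel_left, show -τ + (τ - w) = -w by ring]
    exact mul_ne_zero hw (fun h => hw ((thetaMod_zero_neg_eq_zero_iff η w).mp h))
  -- Subtracting a multiple of the pair with parameter `w` forces a zero at `-τ`; what remains is a
  -- multiple of the pair with parameter `0`.
  obtain ⟨R, hR⟩ := exists_eq_mul_of_zero (a := -τ) η hp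
    (Submodule.sub_mem _ (hmem v) (Submodule.smul_mem _
      (thetaPair p η τ v (-τ) / thetaPair p η τ w (-τ)) (hmem w)))
    (by simp only [Pi.sub_apply, Pi.smul_apply, smul_eq_mul]; field_simp; ring)
  refine ⟨R, thetaPair p η τ v (-τ) / thetaPair p η τ w (-τ), fun u => ?_⟩
  have := hR u
  simp only [Pi.sub_apply, Pi.smul_apply, smul_eq_mul] at this
  rw [sub_eq_iff_eq_add] at this
  rw [this]
  congr 2
  rw [thetaPair, show u - -τ = u + (τ + 0) by ring, show u + (2 * τ + -τ) = u + (τ - 0) by ring]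

/-- Multiplied by `2p`, a zero would put `1/2` into the lattice. Hence `1/(4p)` is an auxiliary
parameter avoiding all zeros that matter. -/
theorem thetaMod_zero_quarter_ne_zero (c : ℤ) (y : ℂ) (hy : 2 * p * y ∈ lattice η) :
    thetaMod p η 0 (y + c * η / p + 1 / (4 * p)) ≠ 0 := by
  have hp0 := cast_ne_zero_of_neZero (p := p)
  rw [Ne, thetaMod_zero_eq_zero_iff]
  rintro ⟨m, n, h⟩
  obtain ⟨m', n', h'⟩ := (mem_lattice_iff η _).mp hy
  refine half_notMem_lattice η ((mem_lattice_iff η _).mpr ⟨2 * m - m', 2 * p * n - 2 * c - n', ?_⟩)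
  field_simp at h
  push_cast
  linear_combination h / 2 - h'

/-- The exponential factor splits into one depending on `k` and one depending on `m`, that is, into
row and column scalings, which do not affect nonsingularity. -/
theorem thetaMod_mul_eq_thetaPair (hp : Odd p) (k m : ℤ) :
    thetaMod p η (k + m : ℤ) τ * thetaMod p η (k - m : ℤ) τ
      = e (2 * k * τ + (k ^ 2 - k * p) / p * η + k) * e (m ^ 2 / p * η) *
        thetaPair p η τ (m * η / p) (k * η / p) := by
  have hp0 := cast_ne_zero_of_neZero (p := p)
  rw [← zero_add ((k + m : ℤ) : ZMod p), ← zero_add ((k - m : ℤ) : ZMod p),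
    thetaMod_add_intCast η hp, thetaMod_add_intCast η hp, shiftFactor, shiftFactor, thetaPair,
    mul_mul_mul_comm, ← e_add, ← e_add]
  congr 2
  · push_cast; field_simp; ring
  · congr 1; push_cast; ring
  · congr 1; push_cast; ring

theorem thetaPair_eq_zero (v : ℂ) (h : ℂ) (hv : h = -τ - v) : thetaPair p η τ v h = 0 := by
  rw [thetaPair, hv, show -τ - v + (τ + v) = 0 by ring, thetaMod_zero_zero, zero_mul]

theorem thetaMod_zero_div_add_ne_zero (c : ℤ) :
    thetaMod p η 0 (c * η / p + 1 / (4 * p)) ≠ 0 := by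
  simpa using thetaMod_zero_quarter_ne_zero c 0 (by simp [(lattice η).zero_mem])

theorem thetaMod_zero_div_sub_ne_zero (c : ℤ) :
    thetaMod p η 0 (c * η / p - 1 / (4 * p)) ≠ 0 := fun h =>
  thetaMod_zero_div_add_ne_zero (p := p) (η := η) (-c) (by
    rw [← thetaMod_zero_neg_eq_zero_iff η, ← h]
    congr 1; push_cast; ring)

theorem IsHalfPeriod.thetaPair_quarter_ne_zero (hτ : IsHalfPeriod η τ) (c : ℤ) :
    thetaPair p η τ (1 / (4 * p)) (c * η / p) ≠ 0 := by
  have hmem : 2 * p * τ ∈ lattice η := by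
    rw [mul_comm (2 : ℂ), mul_assoc]
    simpa using (lattice η).nsmul_mem hτ.two_mul_mem p
  have hmem' : 2 * p * -τ ∈ lattice η := by
    rw [mul_neg]; exact (lattice η).neg_mem hmem
  refine mul_ne_zero ?_ fun h => ?_
  · rw [show (c : ℂ) * η / p + (τ + 1 / (4 * p)) = τ + c * η / p + 1 / (4 * p) by ring]
    exact thetaMod_zero_quarter_ne_zero _ _ hmem
  · refine thetaMod_zero_quarter_ne_zero (p := p) (-c) _ hmem' ?_
    rw [← thetaMod_zero_neg_eq_zero_iff η, ← h]
    congr 1; push_cast; ring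

/-- Evaluate at `-τ - 1/(4p)`, where the second basis function vanishes and the left side does not.
-/
theorem coeff_thetaPair_ne_zero {c : ℤ} {R T : ℂ}
    (hRT : ∀ u, thetaPair p η τ (c * η / p) u
      = R * thetaPair p η τ 0 u + T * thetaPair p η τ (1 / (4 * p)) u) : R ≠ 0 := by
  intro h0
  have h1 := hRT (-τ - 1 / (4 * p))
  rw [h0, thetaPair_eq_zero (1 / (4 * p)) _ rfl, thetaPair, zero_mul, mul_zero, add_zero,
    mul_eq_zero] at h1
  rcases h1 with h1 | h1
  · refine thetaMod_zero_div_sub_ne_zero (p := p) (η := η) c ?_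
    rw [← h1]; congr 1; ring
  · refine thetaMod_zero_div_add_ne_zero (p := p) (η := η) c ?_
    rw [← thetaMod_zero_neg_eq_zero_iff η, ← h1]; congr 1; ring

theorem IsHalfPeriod.thetaPair_ne_zero (hτ : IsHalfPeriod η τ) (hp : Odd p) (k m : ℤ) :
    thetaPair p η τ (m * η / p) (k * η / p) ≠ 0 := fun h => by
  have := thetaMod_mul_eq_thetaPair (τ := τ) (η := η) hp k m
  rw [h, mul_zero] at this
  exact mul_ne_zero (hτ.thetaMod_ne_zero hp _) (hτ.thetaMod_ne_zero hp _) this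

/-- The Sklyanin relations of a fixed weight have maximal rank. -/
theorem IsHalfPeriod.eq_zero_of_sum_eq_zero (hτ : IsHalfPeriod η τ) (hp : Odd p) {ψ : ZMod p → ℂ}
    (hψ0 : ψ 0 = 0) (hψ : ∀ d, ψ (-d) = ψ d)
    (h : ∀ k ≠ 0, ∑ m, ψ m / (thetaMod p η (k + m) τ * thetaMod p η (k - m) τ) = 0) : ψ = 0 := by
  choose R T hRT using exists_thetaPair_eq (τ := τ) (w := 1 / (4 * p)) hp
    (by simpa using thetaMod_zero_div_add_ne_zero (p := p) (η := η) 0)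
  let v : ℤ → ℂ := fun m => m * η / p
  have hne : ∀ i j : ℤ, (i : ZMod p) ≠ j → thetaMod p η 0 (v i - v j) ≠ 0 := fun i j hij h => by
    refine thetaMod_zero_div_ne_zero (p := p) η (c := i - j)
      (by push_cast; exact sub_ne_zero.mpr hij) ?_
    rw [← h]; congr 1; simp only [v]; push_cast; ring
  have hne' : ∀ i j : ℤ, (i + j : ZMod p) ≠ 0 → thetaMod p η 0 (v i + v j) ≠ 0 :=
    fun i j hij h => by
      refine thetaMod_zero_div_ne_zero (p := p) η (c := i + j) (by push_cast; exact hij) ?_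
      rw [← h]; congr 1; simp only [v]; push_cast; ring
  have hw2 : ∀ k, thetaPair p η τ (1 / (4 * p)) (v k) ≠ 0 := hτ.thetaPair_quarter_ne_zero
  have hR : ∀ m, R (v m) ≠ 0 := fun m => coeff_thetaPair_ne_zero (hRT (v m))
  -- Equality would make the values at `v i` and `v j` proportional in the same ratio for every
  -- pair. The pair with parameter `-τ - v j` vanishes at `v j` but not at `v i`.
  have hrow : ∀ i j : ℤ, (i : ZMod p) ≠ j → (i + j : ZMod p) ≠ 0 →
      thetaPair p η τ 0 (v i) * thetaPair p η τ (1 / (4 * p)) (v j)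
        ≠ thetaPair p η τ 0 (v j) * thetaPair p η τ (1 / (4 * p)) (v i) := fun i j hij hij' h3 => by
    have h2 : thetaPair p η τ (-τ - v j) (v i) * thetaPair p η τ (1 / (4 * p)) (v j)
        = thetaPair p η τ (-τ - v j) (v j) * thetaPair p η τ (1 / (4 * p)) (v i) := by
      rw [hRT (-τ - v j) (v i), hRT (-τ - v j) (v j)]
      linear_combination R (-τ - v j) * h3
    rw [thetaPair_eq_zero (-τ - v j) (v j) (by ring), zero_mul, mul_eq_zero] at h2
    have h4 := h2.resolve_right (hw2 j)
    obtain ⟨M, hM, hM2⟩ := hτ.thetaMod_add_two_mul (p := p) hp (v i + v j)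
    rw [thetaPair, show v i + (τ + (-τ - v j)) = v i - v j by ring,
      show v i + (τ - (-τ - v j)) = v i + v j + 2 * τ by ring, hM2] at h4
    exact mul_ne_zero (hne i j hij) (mul_ne_zero hM (hne' i j hij')) h4
  -- Likewise, at `-τ - v j` the pair with parameter `v j` vanishes and the one with parameter `v i`
  -- does not.
  have hcol : ∀ i j : ℤ, (i : ZMod p) ≠ j → (i + j : ZMod p) ≠ 0 →
      T (v i) * R (v j) ≠ T (v j) * R (v i) := fun i j hij hij' h3 => by
    have h2 : thetaPair p η τ (v i) (-τ - v j) * R (v j)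
        = thetaPair p η τ (v j) (-τ - v j) * R (v i) := by
      rw [hRT (v i) (-τ - v j), hRT (v j) (-τ - v j)]
      linear_combination thetaPair p η τ (1 / (4 * p)) (-τ - v j) * h3
    rw [thetaPair_eq_zero (v j) _ rfl, zero_mul, mul_eq_zero] at h2
    have h4 := h2.resolve_right (hR j)
    rw [thetaPair, show -τ - v j + (τ + v i) = v i - v j by ring,
      show -τ - v j + (τ - v i) = -(v i + v j) by ring, mul_eq_zero,
      thetaMod_zero_neg_eq_zero_iff] at h4
    exact h4.elim (hne i j hij) (hne' i j hij')
  -- Restricting to `1, …, (p-1)/2` guarantees that distinct indices are neither equal nor opposite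
  -- modulo `p`. Evenness and `ψ 0 = 0` fold each sum onto this half system, with a factor two.
  have hcauchy := eq_zero_of_rank_two_cauchy
    (ψ := fun m : Finset.Icc 1 ((p - 1) / 2) =>
      ψ ((m : ℕ) : ℤ) / e (((m : ℕ) : ℤ) ^ 2 / p * η))
    (E := fun k m => thetaPair p η τ (v (m : ℕ)) (v (k : ℕ)))
    (fun k m => hRT (v (m : ℕ)) (v (k : ℕ))) (fun k => hw2 _) (fun m => hR _)
    (fun k m => hτ.thetaPair_ne_zero hp _ _)
    (fun i j hij => hrow _ _
      (fun h => hij (Subtype.ext (natCast_injOn_Icc i.2 j.2 (by exact_mod_cast h))))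
      (by exact_mod_cast natCast_add_ne_zero_of_mem_Icc i.2 j.2))
    (fun i j hij => hcol _ _
      (fun h => hij (Subtype.ext (natCast_injOn_Icc i.2 j.2 (by exact_mod_cast h))))
      (by exact_mod_cast natCast_add_ne_zero_of_mem_Icc i.2 j.2))
    (fun k => by
      have h1 := h ((k : ℕ) : ZMod p) (natCast_ne_zero_of_mem_Icc k.2)
      rw [sum_zmod_of_even hp (fun α => by
        rw [hψ, sub_neg_eq_add, ← sub_eq_add_neg, mul_comm (thetaMod p η _ τ)]), hψ0, zero_div,
        zero_add, two_nsmul, ← two_mul, mul_eq_zero] at h1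
      have h2 := h1.resolve_left two_ne_zero
      refine (mul_eq_zero.mp (Eq.trans ?_ h2)).resolve_left (inv_ne_zero (e_ne_zero
        (2 * ((k : ℕ) : ℤ) * τ + (((k : ℕ) : ℤ) ^ 2 - ((k : ℕ) : ℤ) * p) / p * η + ((k : ℕ) : ℤ))))
      rw [Finset.mul_sum]
      refine Finset.sum_congr rfl fun m _ => ?_
      have h3 := thetaMod_mul_eq_thetaPair (τ := τ) (η := η) hp ((k : ℕ) : ℤ) ((m : ℕ) : ℤ)
      push_cast at h3
      rw [h3]
      push_cast
      simp only [v, Int.cast_natCast, div_eq_mul_inv, mul_inv, mul_assoc, mul_left_comm])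
  have hval : ∀ i ∈ Finset.Icc 1 ((p - 1) / 2), ψ (i : ZMod p) = 0 := fun i hi => by
    have h1 := congrFun hcauchy ⟨i, hi⟩
    simpa [e_ne_zero] using h1
  ext α
  by_cases hα : α = 0
  · rw [hα, hψ0]; rfl
  · obtain ⟨i, hi, h1 | h1⟩ := exists_natCast_eq_or_neg hp hα
    · rw [h1, hval i hi]; rfl
    · rw [h1, hψ, hval i hi]; rfl

end

/-! ### Common zeros of the quadratic forms -/

/-- The quadratic form `∑_d φ_d z_{c+d} z_{c-d}`. -/
def quadForm {p : ℕ} [NeZero p] (φ z : ZMod p → ℂ) (c : ZMod p) : ℂ :=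
  ∑ d, φ d * (z (c + d) * z (c - d))

/-- A theta function of order `p` with zeros at the nonzero multiples of `1 / p`, except that two
of the zeros are translated by `τ`. -/
def auxTheta (p : ℕ) (η : UpperHalfPlane) (τ : ℂ) (b : ℤ) (x : ℂ) : ℂ :=
  e (b * x) * (theta η (x + τ) * theta η (x - 1 / p + τ) *
    ∏ s ∈ Finset.range (p - 2), theta η (x - ((s + 2 : ℕ) : ℂ) / p))

theorem auxTheta_eq_zero {p : ℕ} {η : UpperHalfPlane} {τ : ℂ} {s : ℕ} (hs : 2 ≤ s) (hsp : s < p) (b : ℤ) :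
    auxTheta p η τ b (s / p) = 0 := by
  rw [auxTheta, Finset.prod_eq_zero (i := s - 2) (by simp; omega), mul_zero, mul_zero]
  rw [Nat.sub_add_cancel hs, sub_self, theta_zero]

section

variable {p : ℕ} [Fact p.Prime] {η : UpperHalfPlane} {τ : ℂ}

/-- The bijection `(c, d) ↦ (c + d, c - d)`. -/
def sumDiffEquiv (hp : Odd p) : ZMod p × ZMod p ≃ ZMod p × ZMod p where
  toFun q := (q.1 + q.2, q.1 - q.2)
  invFun q := ((q.1 + q.2) / 2, (q.1 - q.2) / 2)
  left_inv q := by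
    have := two_ne_zero_zmod hp
    ext
    · simp only; field_simp; ring
    · simp only; field_simp; ring
  right_inv q := by
    have := two_ne_zero_zmod hp
    ext
    · simp only; field_simp; ring
    · simp only; field_simp; ring

/-- These are eigenvectors of translation by `1/p` with distinct eigenvalues. -/
theorem linearIndependent_of_translation {u : ZMod p} (hu : u ≠ 0) {F : ZMod p → ℂ → ℂ}
    (hF : ∀ α, F α ≠ 0) (hper : ∀ α z, F α (z + 1 / p) = ZMod.stdAddChar (u * α) * F α z) :
    LinearIndependent ℂ F := by
  refine Module.End.eigenvectors_linearIndependent'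
    (LinearMap.funLeft ℂ ℂ (fun z : ℂ => z + 1 / p)) (fun α => ZMod.stdAddChar (u * α)) ?_ F
    fun α => ⟨?_, hF α⟩
  · exact ZMod.injective_stdAddChar.comp (mul_right_injective₀ hu)
  · rw [Module.End.mem_eigenspace_iff]
    ext z
    simp [LinearMap.funLeft_apply, ← hper]

theorem thetaMod_symmetrization (hp : Odd p) {φ : ZMod p → ℂ}
    (hφ : ∀ d z, thetaMod p η d z * thetaMod p η (-d) (z + τ)
        + thetaMod p η (-d) z * thetaMod p η d (z + τ)
        = 2 * φ d * (thetaMod p η 0 z * thetaMod p η 0 (z + τ))) (c d : ZMod p) (x : ℂ) :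
    thetaMod p η (c + d) x * thetaMod p η (c - d) (x + τ)
      + thetaMod p η (c - d) x * thetaMod p η (c + d) (x + τ)
      = 2 * φ d * (thetaMod p η c x * thetaMod p η c (x + τ)) := by
  obtain ⟨c, rfl⟩ := ZMod.intCast_surjective c
  have h0 : ∀ y, thetaMod p η c y = shiftFactor p η c y * thetaMod p η 0 (y + c * η / p) :=
    fun y => by rw [← thetaMod_add_intCast η hp, zero_add]
  rw [add_comm _ d, sub_eq_neg_add]
  simp only [thetaMod_add_intCast η hp]
  rw [h0, h0]
  have := hφ d (x + c * η / p)
  rw [add_right_comm x _ τ] at this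
  linear_combination shiftFactor p η c x * shiftFactor p η c (x + τ) * this

/-- Group the double sum by `c`, half the sum of the indices, and average the terms `(c+d, c-d)` and
`(c-d, c+d)`: each average is a multiple of `θ_c(x) θ_c(x+τ)`. Vanishing of quadratic forms thus
becomes a statement about the zeros of one theta function. -/
theorem sum_mul_sum_eq_quadForm (hp : Odd p) {φ : ZMod p → ℂ}
    (hφ : ∀ d z, thetaMod p η d z * thetaMod p η (-d) (z + τ)
        + thetaMod p η (-d) z * thetaMod p η d (z + τ)
        = 2 * φ d * (thetaMod p η 0 z * thetaMod p η 0 (z + τ))) (z : ZMod p → ℂ) (x : ℂ) :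
    (∑ α, z α * thetaMod p η α x) * (∑ α, z α * thetaMod p η α (x + τ))
      = ∑ c, quadForm φ z c * (thetaMod p η c x * thetaMod p η c (x + τ)) := by
  let A : ZMod p × ZMod p → ℂ := fun q =>
    (z q.1 * thetaMod p η q.1 x) * (z q.2 * thetaMod p η q.2 (x + τ))
  have h1 : (∑ α, z α * thetaMod p η α x) * (∑ α, z α * thetaMod p η α (x + τ)) = ∑ q, A q := by
    rw [Finset.sum_mul_sum, Fintype.sum_prod_type]
  have h2 : ∑ q, A q = ∑ q : ZMod p × ZMod p, A (q.1 + q.2, q.1 - q.2) :=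
    (Equiv.sum_comp (sumDiffEquiv hp) A).symm
  have h3 : ∑ q, A q = ∑ q : ZMod p × ZMod p, A (q.1 - q.2, q.1 + q.2) := by
    rw [← Equiv.sum_comp (Equiv.prodComm (ZMod p) (ZMod p)) A]
    exact (Equiv.sum_comp (sumDiffEquiv hp) (fun q => A q.swap)).symm
  rw [h1, ← mul_right_inj' (two_ne_zero (α := ℂ)), two_mul]
  nth_rewrite 1 [h2]
  rw [h3, ← Finset.sum_add_distrib, Fintype.sum_prod_type, Finset.mul_sum]
  refine Finset.sum_congr rfl fun c _ => ?_
  rw [quadForm, Finset.sum_mul, Finset.mul_sum]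
  refine Finset.sum_congr rfl fun d _ => ?_
  simp only [A]
  linear_combination z (c + d) * z (c - d) * thetaMod_symmetrization hp hφ c d x

theorem IsHalfPeriod.linearIndependent_thetaMod (hτ : IsHalfPeriod η τ) (hp : Odd p) :
    LinearIndependent ℂ (thetaMod p η) :=
  linearIndependent_of_translation one_ne_zero
    (fun α h => hτ.thetaMod_ne_zero hp α (congrFun h τ))
    (fun α z => by rw [thetaMod_add_inv η hp, one_mul])

theorem linearIndependent_thetaMod_mul (hp : Odd p) :
    LinearIndependent ℂ (fun (c : ZMod p) x => thetaMod p η c x * thetaMod p η c (x + τ)) := by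
  refine linearIndependent_of_translation (two_ne_zero_zmod hp) (fun α h => ?_) (fun α z => ?_)
  · obtain ⟨a, rfl⟩ := ZMod.intCast_surjective α
    obtain ⟨w, hw1, hw2⟩ := exists_translates_ne_zero (p := p) η (a * η / p) (τ + a * η / p)
    have := congrFun h w
    rw [← zero_add (a : ZMod p), thetaMod_add_intCast η hp, thetaMod_add_intCast η hp,
      add_assoc w τ] at this
    exact mul_ne_zero (mul_ne_zero (shiftFactor_ne_zero η _ _) hw1)
      (mul_ne_zero (shiftFactor_ne_zero η _ _) hw2) this
  · rw [add_right_comm z _ τ, thetaMod_add_inv η hp, thetaMod_add_inv η hp, mul_mul_mul_comm,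
      ← AddChar.map_add_eq_mul, two_mul]

theorem thetaMod_mem (hp : Odd p) (α : ZMod p) : thetaMod p η α ∈ thetaSpace 1 η p (-1) :=
  ⟨differentiable_thetaMod η α, fun z => by simpa using thetaMod_add_one η hp α z, fun z => by
    rw [thetaMod_add_period η hp]; simp⟩

/-- The `p` functions `θ_α` are independent in a space of dimension at most `p`. -/
theorem IsHalfPeriod.exists_eq_sum (hτ : IsHalfPeriod η τ) (hp : Odd p) {f : ℂ → ℂ}
    (hf : f ∈ thetaSpace 1 η p (-1)) : ∃ z : ZMod p → ℂ, ∀ x, f x = ∑ α, z α * thetaMod p η α x := by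
  have hfin := finite_thetaSpace one_ne_zero (η : ℂ) (NeZero.pos p) (C := -1) (by norm_num)
  have hr := finrank_thetaSpace_le one_ne_zero (η : ℂ) (NeZero.pos p) (C := -1) (by norm_num)
  let g : ZMod p → thetaSpace 1 η p (-1) := fun α => ⟨_, thetaMod_mem hp α⟩
  have hg : LinearIndependent ℂ g := by
    have := hτ.linearIndependent_thetaMod (p := p) hp
    exact LinearIndependent.of_comp (thetaSpace 1 η p (-1)).subtype this
  have hcard : Fintype.card (ZMod p) = Module.finrank ℂ (thetaSpace 1 η p (-1)) :=
    le_antisymm hg.fintype_card_le_finrank (by rwa [ZMod.card])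
  have htop := hg.span_eq_top_of_card_eq_finrank' hcard
  have hmem : (⟨f, hf⟩ : thetaSpace 1 η p (-1)) ∈ Submodule.span ℂ (Set.range g) := by
    rw [htop]; trivial
  obtain ⟨z, hz⟩ := (Submodule.mem_span_range_iff_exists_fun ℂ).mp hmem
  refine ⟨z, fun x => ?_⟩
  have := congrFun (congrArg Subtype.val hz) x
  simpa [g] using this.symm

theorem exists_theta_add_int_mul (η : UpperHalfPlane) (b : ℤ) :
    ∃ C : ℂ, C ≠ 0 ∧ ∀ x, theta η (x + b * η) = C * e (-(b * x)) * theta η x := by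
  induction b using Int.induction_on with
  | zero => exact ⟨1, one_ne_zero, by simp [e_zero]⟩
  | succ b ih =>
    obtain ⟨C, hC, h⟩ := ih
    refine ⟨-C * e (-(b * η)), mul_ne_zero (neg_ne_zero.mpr hC) (e_ne_zero _), fun x => ?_⟩
    rw [show x + ((b + 1 : ℤ) : ℂ) * η = x + (b : ℤ) * η + η by push_cast; ring, theta_add, h]
    have : e (-(((b + 1 : ℤ) : ℂ) * x)) * e (-(b * η))
        = e (-(x + (b : ℤ) * η)) * e (-((b : ℤ) * x)) := by
      rw [← e_add, ← e_add]; congr 1; push_cast; ring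
    linear_combination C * theta η x * this
  | pred b ih =>
    obtain ⟨C, hC, h⟩ := ih
    refine ⟨-C * e (-((b + 1) * η)), mul_ne_zero (neg_ne_zero.mpr hC) (e_ne_zero _), fun x => ?_⟩
    have h1 := theta_add η (x + ((-b - 1 : ℤ) : ℂ) * η)
    rw [show x + ((-b - 1 : ℤ) : ℂ) * η + η = x + (-b : ℤ) * η by push_cast; ring, h] at h1
    have h2 : e (-(((-b - 1 : ℤ) : ℂ) * x)) * e (-((b + 1) * η)) *
        e (-(x + ((-b - 1 : ℤ) : ℂ) * η)) = e (-((-b : ℤ) * x)) := by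
      rw [← e_add, ← e_add]; congr 1; push_cast; ring
    refine mul_left_cancel₀ (neg_ne_zero.mpr (e_ne_zero (-(x + ((-b - 1 : ℤ) : ℂ) * η)))) ?_
    rw [← h1]
    linear_combination -C * theta η x * h2

theorem prod_theta_split (hp2 : 2 ≤ p) (y : ℂ) :
    theta η y * theta η (y - 1 / p) *
      ∏ s ∈ Finset.range (p - 2), theta η (y - ((s + 2 : ℕ) : ℂ) / p) = thetaMod p η 0 y := by
  have h : ∀ s : ℕ, ((s + 2 : ℕ) : ℂ) = ((s + 1 + 1 : ℕ) : ℂ) := fun s => rfl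
  rw [thetaMod_zero, ← prod_theta_sub, ← Nat.sub_add_cancel hp2, Finset.prod_range_succ',
    Finset.prod_range_succ', Nat.sub_add_cancel hp2]
  simp only [h, Nat.cast_zero, zero_div, sub_zero, zero_add, Nat.cast_one]
  ring

/-- Two zeros are moved by `τ`, so the sum of the zeros changes by the period `2τ = a + b η`; the
factor `e (b x)` repairs the automorphy. -/
theorem auxTheta_mem (hp2 : 2 ≤ p) (hp : Odd p) {a b : ℤ} (hab : 2 * τ = a + b * η) :
    auxTheta p η τ b ∈ thetaSpace 1 η p (-1) := by
  refine ⟨?_, fun z => ?_, fun z => ?_⟩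
  · have hd := differentiable_theta η
    have hprod : Differentiable ℂ fun x : ℂ =>
        ∏ s ∈ Finset.range (p - 2), theta η (x - ((s + 2 : ℕ) : ℂ) / p) :=
      Differentiable.fun_finsetProd fun s _ => hd.comp (by fun_prop)
    exact (differentiable_e.comp (by fun_prop)).mul
      (((hd.comp (by fun_prop)).mul (hd.comp (by fun_prop))).mul hprod)
  · have h1 : ∀ u : ℂ, theta η (z + 1 - u) = theta η (z - u) := fun u => by
      rw [add_sub_right_comm, theta_add_one]
    have h2 : ∀ u : ℂ, theta η (z + 1 + u) = theta η (z + u) := fun u => by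
      rw [add_right_comm, theta_add_one]
    have h3 : ∀ u v : ℂ, theta η (z + 1 - u + v) = theta η (z - u + v) := fun u v => by
      rw [add_sub_right_comm, add_right_comm, theta_add_one]
    simp only [Nat.cast_one, div_one, auxTheta, h1, h2, h3, mul_add, mul_one, e_add, e_int]
  · obtain ⟨k, hk⟩ := id hp
    have h1 : ∀ u : ℂ, theta η (z + η - u) = -1 * e (-(z - u)) * theta η (z - u) := fun u => by
      rw [add_sub_right_comm, theta_add]; ring
    have h2 : theta η (z + η + τ) = -e (-(z + τ)) * theta η (z + τ) := by
      rw [add_right_comm, theta_add]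
    have h3 : ∀ u : ℂ, theta η (z + η - u + τ) = -e (-(z - u + τ)) * theta η (z - u + τ) :=
      fun u => by rw [add_sub_right_comm, add_right_comm, theta_add]
    have hsum : ∑ s ∈ Finset.range (p - 2), -(z - ((s + 2 : ℕ) : ℂ) / p)
        = -(p * z) + 2 * z + (k : ℤ) - 1 / p := by
      have h4 := sum_range_div (p := p)
      rw [← Nat.sub_add_cancel hp2, Finset.sum_range_succ', Finset.sum_range_succ',
        Nat.sub_add_cancel hp2] at h4
      simp only [neg_sub, Finset.sum_sub_distrib, Finset.sum_const, Finset.card_range, nsmul_eq_mul]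
      rw [Nat.cast_sub hp2]
      have h5 : ((k : ℤ) : ℂ) = (p - 1) / 2 := by rw [hk]; push_cast; ring
      rw [h5, ← h4]
      push_cast
      simp only [zero_div, add_zero, one_add_one_eq_two, add_assoc]
      ring
    have hsign : (-1 : ℂ) ^ (p - 2) = -1 := by
      rw [show p - 2 = 2 * (k - 1) + 1 by omega, pow_succ, pow_mul]; simp
    simp only [auxTheta, h1, h2, h3, Finset.prod_mul_distrib, prod_e, hsum, Finset.prod_const,
      Finset.card_range, hsign]
    have h6 : e (b * (z + η)) * e (-(z + τ)) * e (-(z - 1 / p + τ)) *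
        e (-(p * z) + 2 * z + (k : ℤ) - 1 / p) = e (-(p * z)) * e (b * z) := by
      have h7 : e (-(p * z)) * e (b * z)
          = e (-(p * z)) * e (b * z) * e (k : ℤ) * e ((-a : ℤ) : ℂ) := by
        rw [e_int, e_int, mul_one, mul_one]
      rw [h7]
      simp only [← e_add]
      congr 1
      push_cast
      linear_combination -hab
    have h8 : e (-(p : ℂ) * ((1 : ℕ) * z)) = e (-(p * z)) := by congr 1; push_cast; ring
    rw [h8]
    linear_combination -(theta η (z + τ) * theta η (z - 1 / p + τ) *
      ∏ s ∈ Finset.range (p - 2), theta η (z - ((s + 2 : ℕ) : ℂ) / p)) * h6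

/-- Replacing `x` by `x + τ` brings a moved zero back up to the period `2τ`. Over the two factors
together, the zeros are those of `θ_0(x) θ_0(x+τ)`. -/
theorem exists_auxTheta_mul (hp2 : 2 ≤ p) {a b : ℤ} (hab : 2 * τ = a + b * η) :
    ∃ C : ℂ, C ≠ 0 ∧ ∀ x, auxTheta p η τ b x * auxTheta p η τ b (x + τ)
      = C * (thetaMod p η 0 x * thetaMod p η 0 (x + τ)) := by
  obtain ⟨C, hC, h⟩ := exists_theta_add_int_mul η b
  have h1 : ∀ y, theta η (y + τ + τ) = C * e (-(b * y)) * theta η y := fun y => by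
    rw [← h, show y + τ + τ = y + b * η + a by linear_combination hab]
    simpa using (Function.Periodic.int_mul (theta_add_one η) a) (y + b * η)
  refine ⟨C ^ 2 * e (b * τ) * e (b * (1 / p)), by simp [hC, e_ne_zero], fun x => ?_⟩
  rw [← prod_theta_split hp2, ← prod_theta_split hp2, auxTheta, auxTheta, h1 x,
    show x + τ - 1 / p + τ = x - 1 / p + τ + τ by ring, h1,
    show x + τ - 1 / (p : ℂ) = x - 1 / p + τ by ring]
  have h2 : e (b * x) * e (b * (x + τ)) * e (-(b * x)) * e (-(b * (x - 1 / p)))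
      = e (b * τ) * e (b * (1 / p)) := by
    simp only [← e_add]; congr 1; ring
  linear_combination C ^ 2 * theta η (x + τ) * theta η (x - 1 / p + τ) * theta η x
    * theta η (x - 1 / p) * (∏ s ∈ Finset.range (p - 2), theta η (x - ((s + 2 : ℕ) : ℂ) / p))
    * (∏ s ∈ Finset.range (p - 2), theta η (x + τ - ((s + 2 : ℕ) : ℂ) / p)) * h2

theorem IsHalfPeriod.auxTheta_zero_ne_zero (hτ : IsHalfPeriod η τ) (hp : Odd p) (b : ℤ) :
    auxTheta p η τ b 0 ≠ 0 := by
  have hp0 := cast_ne_zero_of_neZero (p := p)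
  refine mul_ne_zero (e_ne_zero _) (mul_ne_zero (mul_ne_zero ?_ ?_)
    (Finset.prod_ne_zero_iff.mpr fun s hs => ?_))
  · rw [Ne, theta_eq_zero_iff, zero_add]
    exact hτ.notMem
  · rw [Ne, theta_eq_zero_iff, mem_lattice_iff]
    rintro ⟨m, n, h⟩
    refine hτ.mul_notMem hp ((mem_lattice_iff η _).mpr ⟨p * m + 1, p * n, ?_⟩)
    push_cast
    field_simp at h
    linear_combination h
  · rw [Ne, theta_eq_zero_iff, mem_lattice_iff]
    rintro ⟨m, n, h⟩
    rw [Finset.mem_range] at hs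
    have h2 : ((-(s + 2 : ℕ) : ℤ) + (0 : ℤ) * η : ℂ) = (p * m : ℤ) + (p * n : ℤ) * η := by
      field_simp at h
      push_cast at h ⊢
      linear_combination h
    have h3 := (int_linear_eq η h2).1
    have h4 : (p : ℤ) ∣ (s + 2 : ℕ) := ⟨-m, by linear_combination -h3⟩
    have := Nat.le_of_dvd (by omega) (Int.natCast_dvd_natCast.mp h4)
    omega

theorem thetaMod_natCast_div (hp : Odd p) (α : ZMod p) (n : ℕ) :
    thetaMod p η α (n / p) = ZMod.stdAddChar ((n : ZMod p) * α) * thetaMod p η α 0 := by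
  induction n with
  | zero => simp
  | succ n ih =>
    rw [show ((n + 1 : ℕ) : ℂ) / p = n / p + 1 / p by push_cast; ring,
      thetaMod_add_inv η hp, ih, ← mul_assoc, ← AddChar.map_add_eq_mul]
    congr 2
    push_cast; ring

theorem sum_stdAddChar_mul (β : ZMod p) (y : ZMod p → ℂ) :
    ∑ s : ZMod p, ZMod.stdAddChar (-(s * β)) * ∑ α, ZMod.stdAddChar (s * α) * y α = p * y β := by
  have h1 : ∀ s : ZMod p, ZMod.stdAddChar (-(s * β)) * ∑ α, ZMod.stdAddChar (s * α) * y α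
      = ∑ α, ZMod.stdAddChar (s * (α - β)) * y α := fun s => by
    rw [Finset.mul_sum]
    refine Finset.sum_congr rfl fun α _ => ?_
    rw [← mul_assoc, ← AddChar.map_add_eq_mul]
    congr 2; ring
  simp only [h1]
  rw [Finset.sum_comm]
  simp only [← Finset.sum_mul, AddChar.sum_mulShift _ (ZMod.isPrimitive_stdAddChar p)]
  rw [Finset.sum_eq_single β (fun α _ h => by simp [sub_ne_zero.mpr h]) (by simp)]
  simp [ZMod.card]

/-- There are points at which all but one of the quadratic forms vanish and a given coordinate does
not. -/
theorem IsHalfPeriod.exists_quadForm_eq_zero (hτ : IsHalfPeriod η τ) (hp : Odd p) {φ : ZMod p → ℂ}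
    (hφ : ∀ d z, thetaMod p η d z * thetaMod p η (-d) (z + τ)
        + thetaMod p η (-d) z * thetaMod p η d (z + τ)
        = 2 * φ d * (thetaMod p η 0 z * thetaMod p η 0 (z + τ))) {β : ZMod p} (hβ : β ≠ 0) :
    ∃ z : ZMod p → ℂ, z β ≠ 0 ∧ quadForm φ z 0 ≠ 0 ∧ ∀ c ≠ 0, quadForm φ z c = 0 := by
  have hp0 := cast_ne_zero_of_neZero (p := p)
  have hp2 : 2 ≤ p := (Fact.out : p.Prime).two_le
  obtain ⟨a, b, hab⟩ := (mem_lattice_iff η _).mp hτ.two_mul_mem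
  obtain ⟨z, hz⟩ := hτ.exists_eq_sum hp (auxTheta_mem hp2 hp hab)
  obtain ⟨C, hC, hmul⟩ := exists_auxTheta_mul hp2 hab
  have hf0 := hτ.auxTheta_zero_ne_zero hp b
  -- The products `θ_c(x) θ_c(x+τ)` are independent, so the values of the quadratic forms can be
  -- read off.
  have hq : ∀ c, quadForm φ z c - (if c = 0 then C else 0) = 0 := by
    refine Fintype.linearIndependent_iff.mp (linearIndependent_thetaMod_mul (η := η) (τ := τ) hp) _ ?_
    ext x
    have h1 := hmul x
    rw [hz, hz, sum_mul_sum_eq_quadForm hp hφ] at h1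
    simp only [Finset.sum_apply, Pi.smul_apply, smul_eq_mul, sub_mul, Finset.sum_sub_distrib, h1,
      ite_mul, zero_mul, Finset.sum_ite_eq', Finset.mem_univ, if_true, sub_self, Pi.zero_apply]
  refine ⟨z, ?_, ?_, fun c hc => ?_⟩
  · have hval : ∀ s : ZMod p, ∑ α, ZMod.stdAddChar (s * α) * (z α * thetaMod p η α 0)
        = auxTheta p η τ b ((s.val : ℂ) / p) := fun s => by
      rw [hz]
      refine Finset.sum_congr rfl fun α _ => ?_
      rw [thetaMod_natCast_div hp, ZMod.natCast_zmod_val]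
      ring
    -- Finite Fourier inversion of the values at `s / p`; only `s = 0, 1` contribute, the other
    -- points being zeros.
    have htwo : ∀ β : ZMod p, auxTheta p η τ b 0
        + ZMod.stdAddChar (-β) * auxTheta p η τ b ((1 : ℕ) / p) = p * (z β * thetaMod p η β 0) := by
      intro β
      rw [← sum_stdAddChar_mul β (fun α => z α * thetaMod p η α 0)]
      simp only [hval]
      have : Fact (1 < p) := ⟨by omega⟩
      rw [Finset.sum_eq_add (0 : ZMod p) 1 zero_ne_one]
      · simp [ZMod.val_one]
      · intro s _ hs
        rw [auxTheta_eq_zero _ (ZMod.val_lt s), mul_zero]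
        have h1 : s.val ≠ 0 := by rw [Ne, ZMod.val_eq_zero]; exact hs.1
        have h2 : s.val ≠ 1 := fun h => hs.2 (by
          rw [← ZMod.natCast_zmod_val s, h, Nat.cast_one])
        omega
      · simp
      · simp
    -- Since `θ_0(0) = 0`, index `0` shows that the two surviving values are opposite. So `p z_β
    -- θ_β(0)` is the value at `0` times `1 - ω^{-β}`, which is nonzero for `β ≠ 0`.
    have h0 := htwo 0
    rw [thetaMod_zero_zero, mul_zero, mul_zero, neg_zero, AddChar.map_zero_eq_one, one_mul] at h0
    have h1 := htwo β
    rw [eq_neg_of_add_eq_zero_right h0] at h1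
    intro hzβ
    rw [hzβ, zero_mul, mul_zero] at h1
    have h2 : (ZMod.stdAddChar (-β) : ℂ) = 1 := by
      have : auxTheta p η τ b 0 * (1 - ZMod.stdAddChar (-β)) = 0 := by linear_combination h1
      linear_combination -((mul_eq_zero.mp this).resolve_left hf0)
    have h3 : -β = 0 := ZMod.injective_stdAddChar (h2.trans (AddChar.map_zero_eq_one _).symm)
    exact hβ (neg_eq_zero.mp h3)
  · have := hq 0
    rw [if_pos rfl, sub_eq_zero] at this
    rwa [this]
  · simpa [hc] using hq c

end

/-! ### From Sklyanin relations to relations of Clifford type -/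

section relations

variable {p : ℕ} [Fact p.Prime] {η : UpperHalfPlane} {τ : ℂ}

/-- The quadratic element `{x_{c+d}, x_{c-d}} - 2 φ_d x_c²`. -/
def cliffordRelator (φ : ZMod p → ℂ) (c d : ZMod p) : FreeAlgebra ℂ (ZMod p) :=
  var (c + d) * var (c - d) + var (c - d) * var (c + d) - (2 * φ d) • (var c * var c)

/-- The quadratic element `∑_m v_m x_{c+m} x_{c-m}`, as a linear function of `v`. -/
def quadElement (c : ZMod p) : (ZMod p → ℂ) →ₗ[ℂ] FreeAlgebra ℂ (ZMod p) :=
  Fintype.linearCombination ℂ fun m => var (c + m) * var (c - m)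

theorem quadElement_apply (c : ZMod p) (v : ZMod p → ℂ) :
    quadElement c v = ∑ m, v m • (var (c + m) * var (c - m)) :=
  Fintype.linearCombination_apply _ _ _

/-- The coefficient vector of `{x_{c+d}, x_{c-d}} - 2 φ_d x_c²`. -/
def cliffordVector (φ : ZMod p → ℂ) (d : ZMod p) : ZMod p → ℂ :=
  Pi.single d 1 + Pi.single (-d) 1 - (2 * φ d) • Pi.single 0 1

theorem quadElement_single (c m : ZMod p) :
    quadElement c (Pi.single m 1) = var (c + m) * var (c - m) := by
  simp [quadElement]

theorem quadElement_cliffordVector (φ : ZMod p → ℂ) (c d : ZMod p) :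
    quadElement c (cliffordVector φ d) = cliffordRelator φ c d := by
  rw [cliffordVector, map_sub, map_add, map_smul, quadElement_single, quadElement_single,
    quadElement_single, cliffordRelator, add_zero, sub_zero, sub_neg_eq_add, ← sub_eq_add_neg]

/-- The coefficients `1 / (θ_{k+m}(τ) θ_{k-m}(τ))` of the relations of the Sklyanin algebra. -/
def thetaCoeff (p : ℕ) (η : UpperHalfPlane) (τ : ℂ) (k m : ZMod p) : ℂ :=
  (thetaMod p η (k + m) τ * thetaMod p η (k - m) τ)⁻¹

theorem thetaCoeff_neg (k m : ZMod p) : thetaCoeff p η τ k (-m) = thetaCoeff p η τ k m := by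
  simp only [thetaCoeff, sub_neg_eq_add, ← sub_eq_add_neg, mul_comm]

theorem thetaMod_apply_zero_ne_zero (η : UpperHalfPlane) (hp : Odd p) {α : ZMod p} (hα : α ≠ 0) :
    thetaMod p η α 0 ≠ 0 := by
  have h : ((α.val : ℤ) : ZMod p) = α := by simp
  have := thetaMod_add_intCast η hp (0 : ZMod p) α.val 0
  rw [zero_add, h, zero_add] at this
  rw [this]
  exact mul_ne_zero (shiftFactor_ne_zero _ _ _) (thetaMod_zero_div_ne_zero η (by rwa [h]))

/-- Substituting `r = k - m` centres the relation at `c`. The numerator `θ_{2k}(0)` is nonzero, and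
`θ_α(-τ)` is `θ_α(τ)` up to a factor common to all `α`. -/
theorem IsHalfPeriod.exists_sklyaninRelator_eq (hτ : IsHalfPeriod η τ) (hp : Odd p)
    (c : ZMod p) {k : ZMod p} (hk : k ≠ 0) :
    ∃ l : ℂ, l ≠ 0 ∧
      sklyaninRelator p η τ (c - k) (c + k) = l • quadElement c (thetaCoeff p η τ k) := by
  obtain ⟨M, hM, hneg⟩ := hτ.exists_thetaMod_neg hp
  obtain ⟨h, hN⟩ := thetaN_eq (p := p) η hp
  have hk2 : k + k ≠ 0 := by
    rw [← two_mul]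
    exact mul_ne_zero (two_ne_zero_zmod hp) hk
  refine ⟨thetaMod p η (k + k) 0 * M⁻¹, mul_ne_zero (thetaMod_apply_zero_ne_zero η hp hk2)
    (inv_ne_zero hM), ?_⟩
  rw [sklyaninRelator, quadElement_apply, Finset.smul_sum, ← Equiv.sum_comp (Equiv.subLeft k)]
  refine Finset.sum_congr rfl fun m _ => ?_
  have e1 : c + k - (c - k) = k + k := by ring
  have e2 : k + k - (k - m) = k + m := by ring
  have e3 : c + k - (k - m) = c + m := by ring
  have e4 : c - k + (k - m) = c - m := by ring
  simp only [Equiv.subLeft_apply, e1, e2, e3, e4, smul_smul]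
  congr 1
  rw [hN, hN, hN, hneg, thetaCoeff]
  have h1 : (ZMod.stdAddChar (h * (k + k)) : ℂ) =
      ZMod.stdAddChar (h * (k + m)) * ZMod.stdAddChar (h * (k - m)) := by
    rw [← AddChar.map_add_eq_mul]
    ring_nf
  have h2 : ∀ x : ZMod p, (ZMod.stdAddChar x : ℂ) ≠ 0 := fun x =>
    (AddChar.val_isUnit _ x).ne_zero
  have h3 := hτ.thetaMod_ne_zero hp (k + m)
  have h4 := hτ.thetaMod_ne_zero hp (k - m)
  have h5 := h2 (h * (k + m))
  have h6 := h2 (h * (k - m))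
  rw [h1]
  field_simp

theorem IsHalfPeriod.sklyaninRelations_eq_span (hτ : IsHalfPeriod η τ) (hp : Odd p) :
    sklyaninRelations p η τ =
      Submodule.span ℂ {f | ∃ c k : ZMod p, k ≠ 0 ∧ f = quadElement c (thetaCoeff p η τ k)} := by
  have h2 := two_ne_zero_zmod hp
  apply le_antisymm
  · refine Submodule.span_le.2 ?_
    rintro f ⟨i, j, hij, rfl⟩
    have hk : (j - i) / 2 ≠ 0 := div_ne_zero (sub_ne_zero.2 hij.symm) h2
    obtain ⟨l, -, h⟩ := hτ.exists_sklyaninRelator_eq hp ((i + j) / 2) hk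
    have e1 : (i + j) / 2 - (j - i) / 2 = i := by field_simp; ring
    have e2 : (i + j) / 2 + (j - i) / 2 = j := by field_simp; ring
    rw [e1, e2] at h
    rw [h]
    exact Submodule.smul_mem _ _ (Submodule.subset_span ⟨_, _, hk, rfl⟩)
  · refine Submodule.span_le.2 ?_
    rintro f ⟨c, k, hk, rfl⟩
    obtain ⟨l, hl, h⟩ := hτ.exists_sklyaninRelator_eq hp c hk
    rw [← inv_smul_smul₀ hl (quadElement c _), ← h]
    refine Submodule.smul_mem _ _ (Submodule.subset_span ⟨_, _, ?_, rfl⟩)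
    intro h'
    refine mul_ne_zero h2 hk ?_
    linear_combination -h'

/-- Evenness in `m` produces the anticommutators, and orthogonality to `φ` cancels the terms
supported at `0`. -/
theorem IsHalfPeriod.thetaCoeff_eq_sum (hτ : IsHalfPeriod η τ) (hp : Odd p) {φ : ZMod p → ℂ}
    (hφ : ∀ d z, thetaMod p η d z * thetaMod p η (-d) (z + τ) +
      thetaMod p η (-d) z * thetaMod p η d (z + τ) =
        2 * φ d * (thetaMod p η 0 z * thetaMod p η 0 (z + τ))) {k : ZMod p} (hk : k ≠ 0) :
    thetaCoeff p η τ k = (1 / 2 : ℂ) • ∑ m, thetaCoeff p η τ k m • cliffordVector φ m := by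
  have h0 : ∑ m, thetaCoeff p η τ k m * (2 * φ m) = 0 := by
    rw [← mul_zero (2 : ℂ), ← hτ.sum_coefficients_eq_zero hp hφ hk, Finset.mul_sum]
    refine Finset.sum_congr rfl fun m _ => ?_
    rw [thetaCoeff]
    ring
  have h1 : ∑ m, thetaCoeff p η τ k m • (Pi.single m 1 : ZMod p → ℂ) = thetaCoeff p η τ k := by
    ext x
    simp [Finset.sum_apply, Pi.single_apply]
  have h2 : ∑ m, thetaCoeff p η τ k m • (Pi.single (-m) 1 : ZMod p → ℂ) =
      thetaCoeff p η τ k := by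
    rw [← Equiv.sum_comp (Equiv.neg (ZMod p))]
    simpa only [Equiv.neg_apply, thetaCoeff_neg, neg_neg] using h1
  simp only [cliffordVector, smul_sub, smul_add, Finset.sum_sub_distrib, Finset.sum_add_distrib,
    h1, h2, smul_smul, ← Finset.sum_smul, h0, zero_smul, sub_zero]
  rw [← smul_add, ← two_smul ℂ, smul_smul]
  norm_num

/-- By duality, a functional killing all coefficient vectors must kill this one too. -/
theorem IsHalfPeriod.cliffordVector_mem_span (hτ : IsHalfPeriod η τ) (hp : Odd p)
    {φ : ZMod p → ℂ} (hφ0 : φ 0 = 1) (hφneg : ∀ d, φ (-d) = φ d)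
    (hφ : ∀ d z, thetaMod p η d z * thetaMod p η (-d) (z + τ) +
      thetaMod p η (-d) z * thetaMod p η d (z + τ) =
        2 * φ d * (thetaMod p η 0 z * thetaMod p η 0 (z + τ))) (d : ZMod p) :
    cliffordVector φ d ∈ Submodule.span ℂ (thetaCoeff p η τ '' {k | k ≠ 0}) := by
  by_contra hd
  obtain ⟨f, hf, hbot⟩ := Submodule.exists_dual_map_eq_bot_of_notMem hd inferInstance
  refine hf ?_
  have hzero : ∀ k ≠ 0, f (thetaCoeff p η τ k) = 0 := fun k hk => by
    have : f (thetaCoeff p η τ k) ∈ Submodule.map f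
        (Submodule.span ℂ (thetaCoeff p η τ '' {k | k ≠ 0})) :=
      Submodule.mem_map_of_mem (Submodule.subset_span ⟨k, hk, rfl⟩)
    rwa [hbot, Submodule.mem_bot] at this
  set g : ZMod p → ℂ := fun m => f (Pi.single m 1) with hg
  have hsum : ∀ v : ZMod p → ℂ, f v = ∑ m, v m * g m := fun v => by
    conv_lhs => rw [← Finset.univ_sum_single v]
    rw [map_sum]
    refine Finset.sum_congr rfl fun m _ => ?_
    rw [hg, ← smul_eq_mul, ← map_smul, ← Pi.single_smul, smul_eq_mul, mul_one]
  -- The even part of the functional, corrected by a multiple of `φ` so as to vanish at `0`, meets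
  -- the hypotheses of the rank statement; its value at `d` is the functional on `cliffordVector φ
  -- d`.
  have hψ : (fun m => g m + g (-m) - 2 * g 0 * φ m) = 0 := by
    refine hτ.eq_zero_of_sum_eq_zero hp ?_ ?_ ?_
    · rw [neg_zero, hφ0]; ring
    · intro m
      rw [neg_neg, hφneg]; ring
    · intro k hk
      have h1 : ∑ m, thetaCoeff p η τ k m * g m = 0 := by rw [← hsum, hzero k hk]
      have h2 : ∑ m, thetaCoeff p η τ k m * g (-m) = 0 := by
        rw [← Equiv.sum_comp (Equiv.neg (ZMod p))]
        simpa only [Equiv.neg_apply, thetaCoeff_neg, neg_neg] using h1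
      have h3 := hτ.sum_coefficients_eq_zero hp hφ hk
      calc _ = ∑ m, thetaCoeff p η τ k m * g m + ∑ m, thetaCoeff p η τ k m * g (-m) -
            2 * g 0 * ∑ m, φ m / (thetaMod p η (k + m) τ * thetaMod p η (k - m) τ) := by
            rw [Finset.mul_sum, ← Finset.sum_add_distrib, ← Finset.sum_sub_distrib]
            refine Finset.sum_congr rfl fun m _ => ?_
            rw [thetaCoeff]
            ring
        _ = 0 := by rw [h1, h2, h3]; ring
  have := congrFun hψ d
  rw [cliffordVector, map_sub, map_add, map_smul]
  simp only [Pi.zero_apply, hg] at this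
  rw [smul_eq_mul]
  linear_combination this

/-- The space of relations of the Sklyanin algebra at a point of order two is spanned by the
relations of Clifford type. -/
theorem IsHalfPeriod.sklyaninRelations_eq_span_cliffordRelator (hτ : IsHalfPeriod η τ)
    (hp : Odd p) {φ : ZMod p → ℂ} (hφ0 : φ 0 = 1) (hφneg : ∀ d, φ (-d) = φ d)
    (hφ : ∀ d z, thetaMod p η d z * thetaMod p η (-d) (z + τ) +
      thetaMod p η (-d) z * thetaMod p η d (z + τ) =
        2 * φ d * (thetaMod p η 0 z * thetaMod p η 0 (z + τ))) :
    sklyaninRelations p η τ =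
      Submodule.span ℂ (Set.range fun q : ZMod p × ZMod p => cliffordRelator φ q.1 q.2) := by
  rw [hτ.sklyaninRelations_eq_span hp]
  apply le_antisymm
  · refine Submodule.span_le.2 ?_
    rintro f ⟨c, k, hk, rfl⟩
    rw [SetLike.mem_coe, hτ.thetaCoeff_eq_sum hp hφ hk, map_smul, map_sum]
    refine Submodule.smul_mem _ _ (Submodule.sum_mem _ fun m _ => ?_)
    rw [map_smul, quadElement_cliffordVector]
    exact Submodule.smul_mem _ _ (Submodule.subset_span ⟨(c, m), rfl⟩)
  · refine Submodule.span_le.2 ?_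
    rintro f ⟨⟨c, d⟩, rfl⟩
    have h := Submodule.mem_map_of_mem (f := quadElement c)
      (hτ.cliffordVector_mem_span hp hφ0 hφneg hφ d)
    rw [Submodule.map_span, quadElement_cliffordVector] at h
    refine Submodule.span_mono ?_ h
    rintro _ ⟨_, ⟨k, hk, rfl⟩, rfl⟩
    exact ⟨c, k, hk, rfl⟩

end relations

/-! ### The Heisenberg action and a basis of the relations -/

/-- The coefficient of `x_i x_j` in the quadratic part of an element of the free algebra. -/
def quadCoeff {p : ℕ} (i j : ZMod p) : FreeAlgebra ℂ (ZMod p) →ₗ[ℂ] ℂ :=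
  (LinearMap.proj 2 ∘ₗ LinearMap.proj (φ := fun _ => Fin 3 → ℂ) 0) ∘ₗ
    (Matrix.ofLinearEquiv ℂ).symm.toLinearMap ∘ₗ
    -- Send `x_i` to the matrix unit in position `(0, 1)` and `x_j` to the one in position `(1, 2)`
    -- (to their sum if `i = j`), all other variables to `0`. Only the word `x_i x_j` contributes to
    -- the entry `(0, 2)`.
    (FreeAlgebra.lift ℂ fun a : ZMod p =>
      (!![0, if a = i then 1 else 0, 0; 0, 0, if a = j then 1 else 0; 0, 0, 0] :
        Matrix (Fin 3) (Fin 3) ℂ)).toLinearMap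

theorem quadCoeff_var_mul_var {p : ℕ} (i j a b : ZMod p) :
    quadCoeff i j (var a * var b) = if a = i ∧ b = j then 1 else 0 := by
  by_cases h : a = i <;> simp [quadCoeff, var, h]

section heisenberg

variable {p : ℕ} [Fact p.Prime]

theorem anticommRelator_eq (φ : ZMod p → ℂ) (i : ZMod p) :
    anticommRelator p (-2 * φ i) i = cliffordRelator φ 0 i := by
  rw [anticommRelator, cliffordRelator, zero_add, zero_sub, sq, neg_mul, neg_smul, ← sub_eq_add_neg]

theorem cliffordRelator_zero {φ : ZMod p → ℂ} (hφ0 : φ 0 = 1) (c : ZMod p) :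
    cliffordRelator φ c 0 = 0 := by
  rw [cliffordRelator, hφ0, add_zero, sub_zero, mul_one, two_smul, sub_self]

theorem cliffordRelator_neg {φ : ZMod p → ℂ} (hφneg : ∀ d, φ (-d) = φ d) (c d : ZMod p) :
    cliffordRelator φ c (-d) = cliffordRelator φ c d := by
  rw [cliffordRelator, cliffordRelator, hφneg, ← sub_eq_add_neg, sub_neg_eq_add,
    add_comm (var (c - d) * var (c + d))]

/-- The condition on `u` holds for constants and for characters, so this treats all Heisenberg
generators and their inverses at once. -/
theorem monomialHom_cliffordRelator (φ u : ZMod p → ℂ) (a c d : ZMod p)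
    (hu : u (c + d) * u (c - d) = u c * u c) :
    monomialHom u a (cliffordRelator φ c d) = (u c * u c) • cliffordRelator φ (c + a) d := by
  simp only [cliffordRelator, map_add, map_sub, map_smul, map_mul, monomialHom_var, smul_sub,
    smul_add, smul_mul_smul_comm, hu, mul_comm (u (c - d)) (u (c + d)), smul_comm (2 * φ d)]
  rw [add_right_comm c d a, sub_add_eq_add_sub c d a]

theorem heisAct_e₁_pow (k : ℕ) (φ : ZMod p → ℂ) (i : ZMod p) :
    heisAct p (Heis.e₁ p ^ k) (cliffordRelator φ 0 i) = cliffordRelator φ (-k) i := by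
  have h : heisAct p (Heis.e₁ p ^ k) = actE₁ p ^ k := by
    rw [map_pow]
    congr 1
  rw [h]
  simp only [cliffordRelator, map_add, map_sub, map_smul, map_mul, actE₁_pow_var, zero_add,
    zero_sub, neg_add_eq_sub, neg_sub_left, add_comm i]

/-- The space spanned by the relations of Clifford type is stable under the Heisenberg group. -/
theorem heisAct_mem_span_cliffordRelator (φ : ZMod p → ℂ) (g : Heis p) :
    ∀ f ∈ Submodule.span ℂ (Set.range fun q : ZMod p × ZMod p => cliffordRelator φ q.1 q.2),
      heisAct p g f ∈
        Submodule.span ℂ (Set.range fun q : ZMod p × ZMod p => cliffordRelator φ q.1 q.2) := by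
  set S := Submodule.span ℂ (Set.range fun q : ZMod p × ZMod p => cliffordRelator φ q.1 q.2)
    with hS
  have key : ∀ (u : ZMod p → ℂ) (a : ZMod p), (∀ c d, u (c + d) * u (c - d) = u c * u c) →
      ∀ f ∈ S, monomialHom u a f ∈ S := by
    intro u a hu f hf
    have : S ≤ S.comap (monomialHom u a).toLinearMap := by
      conv_lhs => rw [hS]
      refine Submodule.span_le.2 ?_
      rintro _ ⟨⟨c, d⟩, rfl⟩
      change monomialHom u a (cliffordRelator φ c d) ∈ S
      rw [monomialHom_cliffordRelator φ u a c d (hu c d)]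
      exact Submodule.smul_mem _ _ (Submodule.subset_span ⟨(c + a, d), rfl⟩)
    exact this hf
  have hχ : ∀ s c d : ZMod p, (ZMod.stdAddChar (s * (c + d)) : ℂ) *
      ZMod.stdAddChar (s * (c - d)) = ZMod.stdAddChar (s * c) * ZMod.stdAddChar (s * c) := by
    intro s c d
    rw [← AddChar.map_add_eq_mul, ← AddChar.map_add_eq_mul]
    ring_nf
  induction g using PresentedGroup.induction_on with
  | _ w =>
  induction w using FreeGroup.induction_on with
  | C1 =>
    intro f hf
    simpa using hf
  | of s =>
    intro f hf
    have h : heisAct p (PresentedGroup.mk _ (FreeGroup.of s)) = heisGenAct p s :=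
      PresentedGroup.toGroup.of (heisGenAct_rel p)
    change heisAct p (PresentedGroup.mk _ (FreeGroup.of s)) f ∈ S
    rw [h]
    cases s with
    | e₁ => exact key _ _ (fun _ _ => rfl) f hf
    | e₂ => exact key _ _ (fun c d => by simpa using hχ 1 c d) f hf
    | z => exact key _ _ (fun _ _ => rfl) f hf
  | inv_of s _ =>
    intro f hf
    have h : heisAct p (PresentedGroup.mk _ (FreeGroup.of s)) = heisGenAct p s :=
      PresentedGroup.toGroup.of (heisGenAct_rel p)
    change heisAct p (PresentedGroup.mk _ (FreeGroup.of s)⁻¹) f ∈ S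
    rw [map_inv, map_inv, h]
    cases s with
    | e₁ => exact key _ _ (fun _ _ => rfl) f hf
    | e₂ => exact key _ _ (fun c d => by simpa using hχ (-1) c d) f hf
    | z => exact key _ _ (fun _ _ => rfl) f hf
  | mul x y hx hy =>
    intro f hf
    rw [map_mul, map_mul, AlgEquiv.mul_apply]
    exact hx _ (hy _ hf)

theorem cliffordRelator_mem_span_e₁ (hp : Odd p) {φ : ZMod p → ℂ} (hφ0 : φ 0 = 1)
    (hφneg : ∀ d, φ (-d) = φ d) (c d : ZMod p) :
    cliffordRelator φ c d ∈ Submodule.span ℂ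
      (Set.range fun q : Finset.Icc 1 ((p - 1) / 2) × Fin p =>
        cliffordRelator φ (-((q.2 : ℕ) : ZMod p)) ((q.1 : ℕ) : ZMod p)) := by
  rcases eq_or_ne d 0 with rfl | hd
  · rw [cliffordRelator_zero hφ0]
    exact Submodule.zero_mem _
  obtain ⟨i, hi, h⟩ := exists_natCast_eq_or_neg hp hd
  have h' : cliffordRelator φ c d = cliffordRelator φ c i := by
    rcases h with rfl | rfl
    · rfl
    · exact cliffordRelator_neg hφneg _ _
  rw [h']
  refine Submodule.subset_span ⟨(⟨i, hi⟩, ⟨(-c).val, ZMod.val_lt _⟩), ?_⟩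
  simp

/-- The monomial `x_{c+i} x_{c-i}`, with `c = -k`, occurs in exactly one member of the family: the
indices recover `c` as half their sum and `i` up to sign. -/
theorem linearIndependent_cliffordRelator (hp : Odd p) (φ : ZMod p → ℂ) :
    LinearIndependent ℂ (fun q : Finset.Icc 1 ((p - 1) / 2) × Fin p =>
      cliffordRelator φ (-((q.2 : ℕ) : ZMod p)) ((q.1 : ℕ) : ZMod p)) := by
  have h2 := two_ne_zero_zmod hp
  rw [Fintype.linearIndependent_iff]
  rintro g hg ⟨⟨i, hi⟩, k⟩
  have h := congrArg (quadCoeff (-((k : ℕ) : ZMod p) + (i : ZMod p))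
    (-((k : ℕ) : ZMod p) - (i : ZMod p))) hg
  rw [map_sum, map_zero, Finset.sum_eq_single ⟨⟨i, hi⟩, k⟩] at h
  · have hi0 := natCast_ne_zero_of_mem_Icc hi
    have h3 : ¬ (-((k : ℕ) : ZMod p) - i = -((k : ℕ) : ZMod p) + i ∧
        -((k : ℕ) : ZMod p) + i = -((k : ℕ) : ZMod p) - i) := by
      rintro ⟨h, -⟩
      exact mul_ne_zero h2 hi0 (by linear_combination -h)
    have h4 : ¬ (-((k : ℕ) : ZMod p) = -((k : ℕ) : ZMod p) + i ∧
        -((k : ℕ) : ZMod p) = -((k : ℕ) : ZMod p) - i) := by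
      rintro ⟨h, -⟩
      exact hi0 (by linear_combination -h)
    rw [map_smul, cliffordRelator, map_sub, map_add, map_smul, quadCoeff_var_mul_var,
      quadCoeff_var_mul_var, quadCoeff_var_mul_var, if_neg h3, if_neg h4] at h
    simpa using h
  · rintro ⟨⟨i', hi'⟩, k'⟩ - hne
    have h3 : ¬ (-((k' : ℕ) : ZMod p) + i' = -((k : ℕ) : ZMod p) + i ∧
        -((k' : ℕ) : ZMod p) - i' = -((k : ℕ) : ZMod p) - i) := by
      rintro ⟨h1, h1'⟩
      apply hne
      have e1 : (i' : ZMod p) = i := mul_left_cancel₀ h2 (by linear_combination h1 - h1')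
      have e2 : ((k' : ℕ) : ZMod p) = (k : ℕ) := by linear_combination e1 - h1
      have e3 : i' = i := natCast_injOn_Icc hi' hi e1
      have e4 : k' = k := by
        rw [ZMod.natCast_eq_natCast_iff'] at e2
        rwa [Nat.mod_eq_of_lt k'.2, Nat.mod_eq_of_lt k.2, ← Fin.ext_iff] at e2
      subst e3 e4
      rfl
    have h4 : ¬ (-((k' : ℕ) : ZMod p) - i' = -((k : ℕ) : ZMod p) + i ∧
        -((k' : ℕ) : ZMod p) + i' = -((k : ℕ) : ZMod p) - i) := by
      rintro ⟨h1, h1'⟩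
      refine mul_ne_zero h2 (natCast_add_ne_zero_of_mem_Icc hi hi') ?_
      linear_combination h1' - h1
    have h5 : ¬ (-((k' : ℕ) : ZMod p) = -((k : ℕ) : ZMod p) + i ∧
        -((k' : ℕ) : ZMod p) = -((k : ℕ) : ZMod p) - i) := by
      rintro ⟨h1, h1'⟩
      exact mul_ne_zero h2 (natCast_ne_zero_of_mem_Icc hi) (by linear_combination h1' - h1)
    rw [map_smul, cliffordRelator, map_sub, map_add, map_smul, quadCoeff_var_mul_var,
      quadCoeff_var_mul_var, quadCoeff_var_mul_var, if_neg h3, if_neg h4, if_neg h5]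
    simp
  · simp

end heisenberg

/-! ### Centrality of the squares -/

section centrality

variable {p : ℕ} [Fact p.Prime] {A : Type} [Ring A] [Algebra ℂ A] {φ : ZMod p → ℂ} {x : ZMod p → A}

/-- Averaging over `d ↦ -d` leaves only anticommutators, which the relations turn into multiples of
`x_c²`. -/
theorem sum_smul_mul_self (hp : Odd p)
    (hx : ∀ c d, x (c + d) * x (c - d) + x (c - d) * x (c + d) = (2 * φ d) • (x c * x c))
    (z : ZMod p → ℂ) :
    (∑ i, z i • x i) * ∑ i, z i • x i = ∑ c, quadForm φ z c • (x c * x c) := by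
  have h1 : (∑ i, z i • x i) * ∑ i, z i • x i =
      ∑ c, ∑ d, (z (c + d) * z (c - d)) • (x (c + d) * x (c - d)) := by
    rw [Finset.sum_mul_sum, ← Fintype.sum_prod_type', ← Fintype.sum_prod_type',
      ← Equiv.sum_comp (sumDiffEquiv hp)]
    simp only [smul_mul_smul_comm]
    rfl
  rw [h1]
  refine Finset.sum_congr rfl fun c _ => ?_
  have h2 : ∑ d, (z (c + d) * z (c - d)) • (x (c + d) * x (c - d)) =
      ∑ d, (z (c + d) * z (c - d)) • (x (c - d) * x (c + d)) := by
    rw [← Equiv.sum_comp (Equiv.neg (ZMod p))]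
    simp only [Equiv.neg_apply, sub_neg_eq_add, ← sub_eq_add_neg, mul_comm (z (c - _))]
  rw [← sub_eq_zero, ← smul_eq_zero_iff_right (two_ne_zero (α := ℂ)), smul_sub, two_smul]
  nth_rewrite 2 [h2]
  rw [← Finset.sum_add_distrib, quadForm, Finset.sum_smul, Finset.smul_sum, sub_eq_zero]
  refine Finset.sum_congr rfl fun d _ => ?_
  rw [← smul_add, hx, smul_smul, smul_smul]
  congr 1
  ring

theorem smul_eq_zero_of_sum_stdAddChar {V : Type} [AddCommGroup V] [Module ℂ V]
    {v : ZMod p → V} (h : ∀ s : ZMod p, ∑ j, (ZMod.stdAddChar (s * j) : ℂ) • v j = 0)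
    (i : ZMod p) : v i = 0 := by
  have h1 : ∑ s : ZMod p, (ZMod.stdAddChar (s * -i) : ℂ) •
      ∑ j, (ZMod.stdAddChar (s * j) : ℂ) • v j = 0 := by
    simp only [h, smul_zero, Finset.sum_const_zero]
  simp only [Finset.smul_sum, smul_smul, ← AddChar.map_add_eq_mul, ← mul_add] at h1
  rw [Finset.sum_comm] at h1
  simp only [← Finset.sum_smul,
    AddChar.sum_mulShift _ (ZMod.isPrimitive_stdAddChar p)] at h1
  rw [Finset.sum_eq_single i (fun j _ hj => by
    rw [if_neg (by rwa [neg_add_eq_zero, eq_comm]), Nat.cast_zero, zero_smul]) (by simp)] at h1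
  simpa [NeZero.ne p] using h1

/-- Twists by characters rescale each form and translations permute the forms, so common zeros can
be transported. -/
theorem quadForm_stdAddChar_mul (z : ZMod p → ℂ) (s c : ZMod p) :
    quadForm φ (fun i => (ZMod.stdAddChar (s * i) : ℂ) * z i) c =
      ZMod.stdAddChar (s * (2 * c)) * quadForm φ z c := by
  rw [quadForm, quadForm, Finset.mul_sum]
  refine Finset.sum_congr rfl fun d _ => ?_
  have : s * (2 * c) = s * (c + d) + s * (c - d) := by ring
  rw [this, AddChar.map_add_eq_mul]
  ring

theorem quadForm_comp_sub (z : ZMod p → ℂ) (a c : ZMod p) :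
    quadForm φ (fun i => z (i - a)) c = quadForm φ z (c - a) := by
  simp only [quadForm, add_sub_right_comm, sub_right_comm]

/-- If the quadratic forms `q_c` have a common zero `z` away from `c = 0`, with `z_β ≠ 0` for any
prescribed `β ≠ 0`, then the squares `x_c²` are central. -/
theorem commute_mul_self (hp : Odd p)
    (hx : ∀ c d, x (c + d) * x (c - d) + x (c - d) * x (c + d) = (2 * φ d) • (x c * x c))
    (hz : ∀ β : ZMod p, β ≠ 0 → ∃ z : ZMod p → ℂ, z β ≠ 0 ∧ quadForm φ z 0 ≠ 0 ∧
      ∀ c, c ≠ 0 → quadForm φ z c = 0) (i c : ZMod p) :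
    x i * (x c * x c) = x c * x c * x i := by
  rcases eq_or_ne i c with rfl | hic
  · rw [mul_assoc]
  obtain ⟨z, hzi, hz0, hzc⟩ := hz (i - c) (sub_ne_zero.2 hic)
  have key : ∀ s : ZMod p, ∑ j, (ZMod.stdAddChar (s * j) : ℂ) •
      (z (j - c) • (x j * (x c * x c) - x c * x c * x j)) = 0 := by
    intro s
    -- The point is translated to centre `c` and twisted by a character. Then `X²` is a nonzero
    -- multiple of `x_c²`, so `X` commutes with `x_c²`; letting `s` vary isolates each variable by
    -- Fourier inversion.
    set X := ∑ j, ((ZMod.stdAddChar (s * j) : ℂ) * z (j - c)) • x j with hX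
    have h1 : X * X = ((ZMod.stdAddChar (s * (2 * c)) : ℂ) * quadForm φ z 0) • (x c * x c) := by
      rw [hX, sum_smul_mul_self hp hx, Finset.sum_eq_single c]
      · rw [quadForm_stdAddChar_mul (fun i => z (i - c)), quadForm_comp_sub, sub_self]
      · intro b _ hb
        rw [quadForm_stdAddChar_mul (fun i => z (i - c)), quadForm_comp_sub,
          hzc _ (sub_ne_zero.2 hb), mul_zero, zero_smul]
      · simp
    have h2 : X * (X * X) = X * X * X := (mul_assoc _ _ _).symm
    rw [h1, mul_smul_comm, smul_mul_assoc, ← sub_eq_zero, ← smul_sub, smul_eq_zero_iff_right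
      (mul_ne_zero (AddChar.val_isUnit _ _).ne_zero hz0), hX, Finset.sum_mul, Finset.mul_sum,
      ← Finset.sum_sub_distrib] at h2
    rw [← h2]
    refine Finset.sum_congr rfl fun j _ => ?_
    rw [smul_smul, smul_sub, smul_mul_assoc, mul_smul_comm]
  have := smul_eq_zero_of_sum_stdAddChar key i
  rwa [smul_eq_zero_iff_right hzi, sub_eq_zero] at this

end centrality

/-! ### The matrix of the graded Clifford algebra -/

section matrix

variable {p : ℕ} [Fact p.Prime]

/-- The matrix of linear forms `M_{ij} = 2 φ_{(i-j)/2} y_{(i+j)/2}`. -/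
def cliffordMatrix (φ : ZMod p → ℂ) : Matrix (ZMod p) (ZMod p) (MvPolynomial (ZMod p) ℂ) :=
  fun i j => MvPolynomial.C (2 * φ ((i - j) / 2)) * MvPolynomial.X ((i + j) / 2)

theorem cliffordMatrix_isSymm {φ : ZMod p → ℂ} (hφneg : ∀ d, φ (-d) = φ d) :
    (cliffordMatrix φ).IsSymm := by
  ext1 i j
  rw [Matrix.transpose_apply, cliffordMatrix, cliffordMatrix, add_comm j, ← neg_sub, neg_div,
    hφneg]

theorem cliffordMatrix_isHomogeneous (φ : ZMod p → ℂ) (i j : ZMod p) :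
    (cliffordMatrix φ i j).IsHomogeneous 1 :=
  MvPolynomial.isHomogeneous_C_mul_X _ _

/-- At `y_0 = 1` and all other `y_c = 0`, only the entries with `i + j = 0` survive. Permuting
columns by negation gives the diagonal matrix with entries `2 φ_i`. -/
theorem cliffordMatrix_det_ne_zero (hp : Odd p) {φ : ZMod p → ℂ} (hφ : ∀ d, φ d ≠ 0) :
    (cliffordMatrix φ).det ≠ 0 := by
  intro h
  have h2 := two_ne_zero_zmod hp
  have h1 := congrArg (MvPolynomial.eval (Pi.single 0 1 : ZMod p → ℂ)) h
  rw [RingHom.map_det, map_zero] at h1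
  have h3 : ((MvPolynomial.eval (Pi.single 0 1 : ZMod p → ℂ)).mapMatrix
      (cliffordMatrix φ)).submatrix id (Equiv.neg (ZMod p)) =
        Matrix.diagonal fun i => 2 * φ i := by
    ext i j
    rw [Matrix.submatrix_apply, RingHom.mapMatrix_apply, Matrix.map_apply, cliffordMatrix,
      Matrix.diagonal_apply]
    simp only [id, Equiv.neg_apply, map_mul, MvPolynomial.eval_C, MvPolynomial.eval_X,
      sub_neg_eq_add, ← sub_eq_add_neg, Pi.single_apply, div_eq_zero_iff, h2, or_false,
      sub_eq_zero]
    split_ifs with hij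
    · subst hij
      rw [← two_mul, mul_div_cancel_left₀ _ h2, mul_one]
    · rw [mul_zero]
  have h4 := congrArg Matrix.det h3
  rw [Matrix.det_permute', h1, mul_zero, Matrix.det_diagonal, eq_comm,
    Finset.prod_eq_zero_iff] at h4
  obtain ⟨i, -, hi⟩ := h4
  exact mul_ne_zero two_ne_zero (hφ i) hi

theorem linearForm_cliffordMatrix (φ : ZMod p → ℂ) (i j : ZMod p) :
    linearForm (cliffordMatrix φ i j) =
      (2 * φ ((i - j) / 2)) • FreeAlgebra.ι ℂ (Sum.inr ((i + j) / 2)) := by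
  rw [linearForm, Finset.sum_eq_single ((i + j) / 2)]
  · rw [cliffordMatrix, MvPolynomial.coeff_C_mul, MvPolynomial.coeff_X, if_pos rfl, mul_one]
  · intro k _ hk
    rw [cliffordMatrix, MvPolynomial.coeff_C_mul, MvPolynomial.coeff_X,
      if_neg, mul_zero, zero_smul]
    rw [Finsupp.single_left_inj one_ne_zero]
    exact hk.symm
  · simp

end matrix

/-! ### The graded isomorphism -/

section equivalence

variable {p : ℕ} [Fact p.Prime] {φ : ZMod p → ℂ}

/-- The generators of the graded Clifford algebra of `cliffordMatrix φ`. -/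
def cliffordGen (φ : ZMod p → ℂ) (s : ZMod p ⊕ ZMod p) : CliffordAlg (cliffordMatrix φ) :=
  RingQuot.mkAlgHom ℂ (CliffordRel (cliffordMatrix φ)) (FreeAlgebra.ι ℂ s)

theorem cliffordGen_anticomm (hp : Odd p) (c d : ZMod p) :
    cliffordGen φ (.inl (c + d)) * cliffordGen φ (.inl (c - d)) +
      cliffordGen φ (.inl (c - d)) * cliffordGen φ (.inl (c + d)) =
        (2 * φ d) • cliffordGen φ (.inr c) := by
  have h2 := two_ne_zero_zmod hp
  have h := RingQuot.mkAlgHom_rel ℂ (CliffordRel.anticomm (M := cliffordMatrix φ) (c + d) (c - d))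
  have e1 : (c + d - (c - d)) / 2 = d := by field_simp; ring
  have e2 : (c + d + (c - d)) / 2 = c := by field_simp; ring
  rwa [linearForm_cliffordMatrix, e1, e2, map_add, map_mul, map_mul, map_smul] at h

/-- The normalization `φ 0 = 1` makes the `y_c` redundant as generators. -/
theorem cliffordGen_inr (hp : Odd p) (hφ0 : φ 0 = 1) (c : ZMod p) :
    cliffordGen φ (.inr c) = cliffordGen φ (.inl c) * cliffordGen φ (.inl c) := by
  have h := cliffordGen_anticomm (φ := φ) hp c 0
  rw [add_zero, sub_zero, hφ0, mul_one, ← two_smul ℂ] at h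
  exact (smul_right_injective _ two_ne_zero h).symm

variable {η : UpperHalfPlane} {τ : ℂ}

theorem sklyanin_anticomm (hrel : sklyaninRelations p η τ =
      Submodule.span ℂ (Set.range fun q : ZMod p × ZMod p => cliffordRelator φ q.1 q.2))
    (c d : ZMod p) :
    (Sklyanin.x (c + d) * Sklyanin.x (c - d) + Sklyanin.x (c - d) * Sklyanin.x (c + d) :
      Sklyanin p η τ) = (2 * φ d) • (Sklyanin.x c * Sklyanin.x c) := by
  have h := RingQuot.mkAlgHom_rel ℂ
    (s := fun f g : FreeAlgebra ℂ (ZMod p) => f ∈ sklyaninRelations p η τ ∧ g = 0)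
    (x := cliffordRelator φ c d) (y := 0)
    ⟨by rw [hrel]; exact Submodule.subset_span ⟨(c, d), rfl⟩, rfl⟩
  rw [cliffordRelator, map_sub, map_add, map_smul, map_mul, map_mul, map_mul, map_zero,
    sub_eq_zero] at h
  exact h

theorem lift_eq_zero_of_mem_sklyaninRelations {A : Type} [Ring A] [Algebra ℂ A] {x : ZMod p → A}
    (hrel : sklyaninRelations p η τ =
      Submodule.span ℂ (Set.range fun q : ZMod p × ZMod p => cliffordRelator φ q.1 q.2))
    (hx : ∀ c d, x (c + d) * x (c - d) + x (c - d) * x (c + d) = (2 * φ d) • (x c * x c))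
    {f : FreeAlgebra ℂ (ZMod p)} (hf : f ∈ sklyaninRelations p η τ) :
    FreeAlgebra.lift ℂ x f = 0 := by
  have : sklyaninRelations p η τ ≤ LinearMap.ker (FreeAlgebra.lift ℂ x).toLinearMap := by
    rw [hrel]
    refine Submodule.span_le.2 ?_
    rintro _ ⟨⟨c, d⟩, rfl⟩
    simp [cliffordRelator, var, hx]
  exact this hf

/-- The homomorphism from the Sklyanin algebra to the Clifford algebra, `x_i ↦ x_i`. -/
def sklyaninToClifford (hp : Odd p) (hφ0 : φ 0 = 1) (hrel : sklyaninRelations p η τ =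
      Submodule.span ℂ (Set.range fun q : ZMod p × ZMod p => cliffordRelator φ q.1 q.2)) :
    Sklyanin p η τ →ₐ[ℂ] CliffordAlg (cliffordMatrix φ) :=
  RingQuot.liftAlgHom ℂ ⟨FreeAlgebra.lift ℂ fun i => cliffordGen φ (.inl i), by
    rintro f _ ⟨hf, rfl⟩
    rw [map_zero]
    refine lift_eq_zero_of_mem_sklyaninRelations hrel (fun c d => ?_) hf
    rw [cliffordGen_anticomm hp, cliffordGen_inr hp hφ0]⟩

theorem sklyaninToClifford_x (hp : Odd p) (hφ0 : φ 0 = 1) (hrel : sklyaninRelations p η τ =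
      Submodule.span ℂ (Set.range fun q : ZMod p × ZMod p => cliffordRelator φ q.1 q.2))
    (i : ZMod p) :
    sklyaninToClifford hp hφ0 hrel (Sklyanin.x i) = cliffordGen φ (.inl i) := by
  rw [sklyaninToClifford, Sklyanin.x, RingQuot.liftAlgHom_mkAlgHom_apply, var,
    FreeAlgebra.lift_ι_apply]

/-- The homomorphism from the Clifford algebra to the Sklyanin algebra, `x_i ↦ x_i`, `y_i ↦ x_i²`,
provided that the squares of the generators of the Sklyanin algebra are central. -/
def cliffordToSklyanin (hp : Odd p) (hrel : sklyaninRelations p η τ =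
      Submodule.span ℂ (Set.range fun q : ZMod p × ZMod p => cliffordRelator φ q.1 q.2))
    (hcomm : ∀ i c : ZMod p, (Sklyanin.x i * (Sklyanin.x c * Sklyanin.x c) : Sklyanin p η τ) =
      Sklyanin.x c * Sklyanin.x c * Sklyanin.x i) :
    CliffordAlg (cliffordMatrix φ) →ₐ[ℂ] Sklyanin p η τ :=
  RingQuot.liftAlgHom ℂ ⟨FreeAlgebra.lift ℂ
      (Sum.elim Sklyanin.x fun c => Sklyanin.x c * Sklyanin.x c), by
    have h2 := two_ne_zero_zmod hp
    rintro _ _ (⟨i, j⟩ | ⟨i, j⟩ | ⟨i, j⟩)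
    · have h := sklyanin_anticomm hrel ((i + j) / 2) ((i - j) / 2)
      have e1 : (i + j) / 2 + (i - j) / 2 = i := by field_simp; ring
      have e2 : (i + j) / 2 - (i - j) / 2 = j := by field_simp; ring
      rw [e1, e2] at h
      simpa [linearForm_cliffordMatrix] using h
    · simpa using hcomm i j
    · simp only [map_mul, FreeAlgebra.lift_ι_apply, Sum.elim_inr]
      rw [mul_assoc, hcomm, ← mul_assoc, hcomm, mul_assoc]⟩

theorem cliffordToSklyanin_gen (hp : Odd p) (hrel : sklyaninRelations p η τ =
      Submodule.span ℂ (Set.range fun q : ZMod p × ZMod p => cliffordRelator φ q.1 q.2))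
    (hcomm : ∀ i c : ZMod p, (Sklyanin.x i * (Sklyanin.x c * Sklyanin.x c) : Sklyanin p η τ) =
      Sklyanin.x c * Sklyanin.x c * Sklyanin.x i) (s : ZMod p ⊕ ZMod p) :
    cliffordToSklyanin hp hrel hcomm (cliffordGen φ s) =
      (Sum.elim Sklyanin.x fun c => Sklyanin.x c * Sklyanin.x c : _ → Sklyanin p η τ) s := by
  rw [cliffordToSklyanin, cliffordGen, RingQuot.liftAlgHom_mkAlgHom_apply,
    FreeAlgebra.lift_ι_apply]

/-- The Sklyanin algebra is isomorphic to the Clifford algebra of `cliffordMatrix φ`, if its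
relations are of Clifford type and the squares of its generators are central. -/
def sklyaninEquivClifford (hp : Odd p) (hφ0 : φ 0 = 1) (hrel : sklyaninRelations p η τ =
      Submodule.span ℂ (Set.range fun q : ZMod p × ZMod p => cliffordRelator φ q.1 q.2))
    (hcomm : ∀ i c : ZMod p, (Sklyanin.x i * (Sklyanin.x c * Sklyanin.x c) : Sklyanin p η τ) =
      Sklyanin.x c * Sklyanin.x c * Sklyanin.x i) :
    Sklyanin p η τ ≃ₐ[ℂ] CliffordAlg (cliffordMatrix φ) :=
  AlgEquiv.ofAlgHom (sklyaninToClifford hp hφ0 hrel) (cliffordToSklyanin hp hrel hcomm)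
    (by
      apply RingQuot.ringQuot_ext'
      ext s
      change sklyaninToClifford hp hφ0 hrel (cliffordToSklyanin hp hrel hcomm (cliffordGen φ s)) =
        cliffordGen φ s
      rw [cliffordToSklyanin_gen]
      cases s with
      | inl i => exact sklyaninToClifford_x hp hφ0 hrel i
      | inr c =>
        rw [Sum.elim_inr, map_mul, sklyaninToClifford_x, cliffordGen_inr hp hφ0])
    (by
      apply RingQuot.ringQuot_ext'
      ext i
      change cliffordToSklyanin hp hrel hcomm (sklyaninToClifford hp hφ0 hrel (Sklyanin.x i)) =
        Sklyanin.x i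
      rw [sklyaninToClifford_x, cliffordToSklyanin_gen, Sum.elim_inl])

theorem map_grading_sklyaninEquivClifford (hp : Odd p) (hφ0 : φ 0 = 1)
    (hrel : sklyaninRelations p η τ =
      Submodule.span ℂ (Set.range fun q : ZMod p × ZMod p => cliffordRelator φ q.1 q.2))
    (hcomm : ∀ i c : ZMod p, (Sklyanin.x i * (Sklyanin.x c * Sklyanin.x c) : Sklyanin p η τ) =
      Sklyanin.x c * Sklyanin.x c * Sklyanin.x i) (d : ℕ) :
    (Sklyanin.grading p η τ d).map (sklyaninEquivClifford hp hφ0 hrel hcomm).toLinearMap =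
      CliffordAlg.grading (cliffordMatrix φ) d := by
  have hprod : ∀ w : List (ZMod p), sklyaninEquivClifford hp hφ0 hrel hcomm
      (w.map Sklyanin.x).prod = (w.map fun i => cliffordGen φ (.inl i)).prod := by
    intro w
    rw [map_list_prod, List.map_map]
    congr 2
    ext i
    exact sklyaninToClifford_x hp hφ0 hrel i
  rw [Sklyanin.grading, CliffordAlg.grading, gradedPiece, gradedPiece, Submodule.map_span]
  apply le_antisymm
  · refine Submodule.span_mono ?_
    rintro _ ⟨_, ⟨w, hw, rfl⟩, rfl⟩
    refine ⟨w.map .inl, ?_, ?_⟩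
    · rw [← hw, List.map_map]
      rfl
    · rw [List.map_map]
      exact hprod w
  · refine Submodule.span_mono ?_
    -- Each `y_c` of weight two is replaced by `x_c x_c`, which preserves the total weight of a
    -- word.
    have key : ∀ w : List (ZMod p ⊕ ZMod p), ∃ v : List (ZMod p),
        (v.map fun _ => 1).sum = (w.map (Sum.elim (fun _ => 1) fun _ => 2)).sum ∧
        (v.map fun i => cliffordGen φ (.inl i)).prod = (w.map (cliffordGen φ)).prod := by
      intro w
      induction w with
      | nil => exact ⟨[], rfl, rfl⟩
      | cons s w ih =>
        obtain ⟨v, h1, h2⟩ := ih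
        cases s with
        | inl i =>
          refine ⟨i :: v, ?_, ?_⟩
          · simp only [List.map_cons, List.sum_cons, h1, Sum.elim_inl]
          · simp only [List.map_cons, List.prod_cons, h2]
        | inr c =>
          refine ⟨c :: c :: v, ?_, ?_⟩
          · simp only [List.map_cons, List.sum_cons, h1, Sum.elim_inr]
            ring
          · simp only [List.map_cons, List.prod_cons, h2, cliffordGen_inr hp hφ0, mul_assoc]
    rintro _ ⟨w, hw, rfl⟩
    obtain ⟨v, h1, h2⟩ := key w
    exact ⟨_, ⟨v, h1.trans hw, rfl⟩, (hprod v).trans h2⟩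

end equivalence

theorem isHalfPeriod_of_addOrderOf {η : UpperHalfPlane} {τ : ℂ}
    (hτ : addOrderOf (QuotientAddGroup.mk τ : Curve η) = 2) : IsHalfPeriod η τ := by
  constructor
  · intro h
    rw [(QuotientAddGroup.eq_zero_iff τ).2 h, addOrderOf_zero] at hτ
    omega
  · rw [← QuotientAddGroup.eq_zero_iff]
    have h := addOrderOf_nsmul_eq_zero (QuotientAddGroup.mk τ : Curve η)
    rw [hτ] at h
    rw [two_mul, QuotientAddGroup.mk_add, ← two_nsmul, h]

end SklyaninClifford

end

theorem mainTheorem1 (p : ℕ) [Fact p.Prime] (hp : Odd p) (η : UpperHalfPlane) (τ : ℂ)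
    (hτ : addOrderOf (QuotientAddGroup.mk τ : SklyaninClifford.Curve η) = 2) :
    SklyaninClifford.IsGradedClifford (ZMod p) (SklyaninClifford.Sklyanin.grading p η τ) ∧
    ∃ a : ℕ → ℂ,
      Submodule.span ℂ {f | ∃ g : SklyaninClifford.Heis p, ∃ i ∈ Finset.Icc 1 ((p - 1) / 2),
          f = SklyaninClifford.heisAct p g (SklyaninClifford.anticommRelator p (a i) i)}
        = SklyaninClifford.sklyaninRelations p η τ ∧
      LinearIndependent ℂ (fun q : Finset.Icc 1 ((p - 1) / 2) × Fin p =>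
        SklyaninClifford.heisAct p (SklyaninClifford.Heis.e₁ p ^ (q.2 : ℕ))
          (SklyaninClifford.anticommRelator p (a q.1) ((q.1 : ℕ) : ZMod p))) ∧
      Submodule.span ℂ (Set.range (fun q : Finset.Icc 1 ((p - 1) / 2) × Fin p =>
        SklyaninClifford.heisAct p (SklyaninClifford.Heis.e₁ p ^ (q.2 : ℕ))
          (SklyaninClifford.anticommRelator p (a q.1) ((q.1 : ℕ) : ZMod p))))
        = SklyaninClifford.sklyaninRelations p η τ := by
  open SklyaninClifford in
  have hτ' := isHalfPeriod_of_addOrderOf hτ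
  obtain ⟨φ, hφ0, hφneg, hφne, hφ⟩ := hτ'.exists_coefficients hp
  have hrel := hτ'.sklyaninRelations_eq_span_cliffordRelator hp hφ0 hφneg hφ
  have hcomm := commute_mul_self hp (sklyanin_anticomm hrel)
    fun β hβ => hτ'.exists_quadForm_eq_zero hp hφ hβ
  refine ⟨⟨cliffordMatrix φ, cliffordMatrix_isSymm hφneg, cliffordMatrix_isHomogeneous φ,
    cliffordMatrix_det_ne_zero hp hφne, sklyaninEquivClifford hp hφ0 hrel hcomm,
    map_grading_sklyaninEquivClifford hp hφ0 hrel hcomm⟩, fun i => -2 * φ i, ?_⟩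
  simp only [anticommRelator_eq, heisAct_e₁_pow]
  have hspan : Submodule.span ℂ (Set.range fun q : Finset.Icc 1 ((p - 1) / 2) × Fin p =>
      cliffordRelator φ (-((q.2 : ℕ) : ZMod p)) ((q.1 : ℕ) : ZMod p)) =
        sklyaninRelations p η τ := by
    rw [hrel]
    apply le_antisymm
    · refine Submodule.span_mono ?_
      rintro _ ⟨q, rfl⟩
      exact ⟨(_, _), rfl⟩
    · refine Submodule.span_le.2 ?_
      rintro _ ⟨⟨c, d⟩, rfl⟩
      exact cliffordRelator_mem_span_e₁ hp hφ0 hφneg c d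
  -- For the span of the orbits, stability under the whole group bounds it above, and the powers of
  -- `e₁` alone already fill the space.
  refine ⟨le_antisymm ?_ ?_, linearIndependent_cliffordRelator hp φ, hspan⟩
  · rw [hrel]
    refine Submodule.span_le.2 ?_
    rintro _ ⟨g, i, -, rfl⟩
    exact heisAct_mem_span_cliffordRelator φ g _ (Submodule.subset_span ⟨(_, _), rfl⟩)
  · rw [← hspan]
    refine Submodule.span_mono ?_
    rintro _ ⟨⟨⟨i, hi⟩, k⟩, rfl⟩
    exact ⟨Heis.e₁ p ^ (k : ℕ), i, hi, (heisAct_e₁_pow _ _ _).symm⟩
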